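/- **Setting.** For $\mathbf d=(d_1,d_2)\in\mathbb Z^2$ let $\deg\mathbf d=d_1+d_2$; order $\mathbb Z^2$ componentwise and write $\mathbf 1=(1,1)$. A function on $\mathbb Z^2$ is *initially* (resp. *eventually*) *zero* if it vanishes in all sufficiently small (resp. large) degrees. A *Riemann function* is an initially zero $f\colon\mathbb Z^2\to\mathbb Z$ such that for some $C\in\mathbb Z$, $f(\mathbf d)=\deg\mathbf d+C$ for all $\mathbf d$ of sufficiently large degree; its *weight* is the unique initially zero $W\colon\mathbb Z^2\to\mathbb Z$ with $f(\mathbf d)=\sum_{\mathbf d'\le\mathbf d}W(\mathbf d')$. Put $W^*_{\mathbf L}(\mathbf d)=W(\mathbf L-\mathbf d)$. A *perfect matching* is an initially and eventually zero $W$ for which there is a bijection $\pi\colon\mathbb Z\to\mathbb Z$ with $W(i,j)=1$ if $j=\pi(i)$ and $W(i,j)=0$ otherwise. Let $k$ be a field. A *$k$-diagram* $\mathcal F$ consists of $k$-vector spaces $\mathcal F(B_1),\mathcal F(B_2),\mathcal F(B_3),\mathcal F(A_1),\mathcal F(A_2)$ and linear maps $\rho_{ij}\colon\mathcal F(B_i)\to\mathcal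 F(A_j)$ for $(i,j)=(1,1),(2,2),(3,1),(3,2)$; $H^0(\mathcal F)$ and $H^1(\mathcal F)$ are the kernel and cokernel of $$(b_1,b_2,b_3)\mapsto(\rho_{11}b_1-\rho_{31}b_3,\ \rho_{22}b_2-\rho_{32}b_3),$$ and $\mathcal F$ is *Fredholm* if both are finite dimensional. Isomorphisms and direct sums of $k$-diagrams are taken value by value. For a perfect matching $W$ and $\mathbf d\in\mathbb Z^2$, $\mathcal M_{W,\mathbf d}$ is the (Fredholm) $k$-diagram with $B_i$-value $k^{\oplus\mathbb Z_{\le d_i}}$ and $A_i$-value $k^{\oplus\mathbb Z}$ ($i=1,2$), with $\rho_{11},\rho_{22}$ the inclusions, with $B_3$-value $k^{\oplus\{\mathbf a:\,W(\mathbf a)=1\}}$, and with $\rho_{31},\rho_{32}$ induced by the two coordinate projections. A *virtual $k$-diagram* (resp. *virtual $k$-vector space*) is a formal difference $X_1\ominus X_2$ of Fredholm $k$-diagrams (resp. finite-dimensional $k$-vector spaces), where $X_1\ominus X_2$ and $X_3\ominus X_4$ are identified, and called isomorphic, if $X_1\oplus X_4\oplus X_0\simeq X_3\oplus X_2\oplus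 X_0$ for some such $X_0$. Put $H^i(\mathcal F_1\ominus\mathcal F_2)=H^i(\mathcal F_1)\ominus H^i(\mathcal F_2)$ and $(V_1\ominus V_2)^*=V_1^*\ominus V_2^*$. If $$W=(W_1+\cdots+W_s)-(\tilde W_1+\cdots+\tilde W_{s-1})$$ with $s\ge1$ and all $W_i,\tilde W_j$ perfect matchings, then $[\mathcal M_{W,\mathbf d}]$ denotes the class of $$(\mathcal M_{W_1,\mathbf d}\oplus\cdots\oplus\mathcal M_{W_s,\mathbf d})\ominus(\mathcal M_{\tilde W_1,\mathbf d}\oplus\cdots\oplus\mathcal M_{\tilde W_{s-1},\mathbf d}).$$ **Theorem.** Let $W$ be the weight of a Riemann function $\mathbb Z^2\to\mathbb Z$, let $k$ be a field, let $\mathbf d,\mathbf K\in\mathbb Z^2$, and let $\mathbf L=\mathbf K+\mathbf 1$. 1. If $W$ is bounded, then both $W$ and $W^*_{\mathbf L}$ can be written as such a difference of sums of perfect matchings. 2. For every way of writing $W$ and every way of writing $W^*_{\mathbf L}$ as such a difference, there are isomorphisms of virtual $k$-vector spaces $$H^i([\mathcal M_{W,\mathbf d}])^*\ \to\ H^{1-i}([\mathcal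 M_{W^*_{\mathbf L},\mathbf K-\mathbf d}])\qquad(i=0,1).$$ -/

import Mathlib

universe u

namespace RiemannDuality

/-! ### Riemann functions on `ℤ²`, weights, perfect matchings

`ℤ²` is `ℤ × ℤ` with its componentwise order; `1 : ℤ × ℤ` is the vector `(1, 1)`. -/

/-- The degree of an element of `ℤ²`. -/
def deg (d : ℤ × ℤ) : ℤ := d.1 + d.2

/-- `f` vanishes in all sufficiently small degrees. -/
def InitiallyZero (f : ℤ × ℤ → ℤ) : Prop := ∃ a : ℤ, ∀ d, deg d ≤ a → f d = 0

/-- `f` vanishes in all sufficiently large degrees. -/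
def EventuallyZero (f : ℤ × ℤ → ℤ) : Prop := ∃ b : ℤ, ∀ d, b ≤ deg d → f d = 0

/-- Riemann functions `ℤ² → ℤ`. -/
def IsRiemannFunction (f : ℤ × ℤ → ℤ) : Prop :=
  InitiallyZero f ∧ ∃ C b : ℤ, ∀ d, b ≤ deg d → f d = deg d + C

/-- `W` is the weight of `f`: the initially zero function with `f d = ∑_{d' ≤ d} W d'`.
For initially zero `W` this sum has only finitely many nonzero terms. -/
def IsWeightOf (W f : ℤ × ℤ → ℤ) : Prop :=
  InitiallyZero W ∧ ∀ d, f d = ∑ᶠ d' ∈ Set.Iic d, W d'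

/-- The `L`-dual weight `W*_L`. -/
def dualWeight (L : ℤ × ℤ) (W : ℤ × ℤ → ℤ) : ℤ × ℤ → ℤ := fun d => W (L - d)

/-- Perfect matchings. -/
def IsPerfectMatching (W : ℤ × ℤ → ℤ) : Prop :=
  InitiallyZero W ∧ EventuallyZero W ∧
    ∃ π : Equiv.Perm ℤ, ∀ i j : ℤ, W (i, j) = if j = π i then 1 else 0

/-- A way of writing `W = (W₁ + ⋯ + W_{s+1}) - (W̃₁ + ⋯ + W̃_s)` with all `W_i`, `W̃_j` perfect
matchings. -/
structure MatchingDecomposition (W : ℤ × ℤ → ℤ) where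
  s : ℕ
  pos : Fin (s + 1) → (ℤ × ℤ → ℤ)
  neg : Fin s → (ℤ × ℤ → ℤ)
  pos_perfect : ∀ i, IsPerfectMatching (pos i)
  neg_perfect : ∀ j, IsPerfectMatching (neg j)
  eq_sub : ∀ d, W d = ∑ i, pos i d - ∑ j, neg j d

/-! ### Virtual (finite-dimensional) vector spaces -/

section VirtualVectorSpaces

variable (k : Type u) [Field k]

/-- Isomorphism of finite-dimensional `k`-vector spaces. -/
instance vecSetoid : Setoid (FGModuleCat.{u} k) where
  r V W := Nonempty (V ≃ₗ[k] W)
  iseqv :=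
    { refl := fun V => ⟨LinearEquiv.refl k V⟩
      symm := fun ⟨e⟩ => ⟨e.symm⟩
      trans := fun ⟨e⟩ ⟨e'⟩ => ⟨e.trans e'⟩ }

/-- Isomorphism classes of finite-dimensional `k`-vector spaces. -/
def VecClass : Type (u + 1) := Quotient (vecSetoid k)

/-- The isomorphism class of `V`. -/
def VecClass.mk {k : Type u} [Field k] (V : FGModuleCat.{u} k) : VecClass k :=
  Quotient.mk (vecSetoid k) V

/-- Addition is direct sum. -/
instance : Add (VecClass k) where
  add := Quotient.map₂ (fun V W => FGModuleCat.of k (V × W))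
    (fun _ _ ⟨e⟩ _ _ ⟨e'⟩ => ⟨e.prodCongr e'⟩)

instance : Zero (VecClass k) where
  zero := Quotient.mk _ (FGModuleCat.of k PUnit.{u + 1})

instance : AddCommMonoid (VecClass k) where
  add_assoc := by
    rintro ⟨U⟩ ⟨V⟩ ⟨W⟩
    exact Quotient.sound ⟨LinearEquiv.prodAssoc k U V W⟩
  zero_add := by
    rintro ⟨V⟩
    exact Quotient.sound ⟨LinearEquiv.uniqueProd⟩
  add_zero := by
    rintro ⟨V⟩
    exact Quotient.sound ⟨LinearEquiv.prodUnique⟩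
  add_comm := by
    rintro ⟨V⟩ ⟨W⟩
    exact Quotient.sound ⟨LinearEquiv.prodComm k V W⟩
  nsmul := nsmulRec

/-- Equivalence classes of virtual (finite-dimensional) `k`-vector spaces `V₁ ⊖ V₂`: the
Grothendieck group of the monoid of isomorphism classes under direct sum. Its equality is spelled
out in `VirtualSpace.mk_eq_mk_iff`. -/
abbrev VirtualSpace : Type (u + 1) := Algebra.GrothendieckAddGroup (VecClass k)

variable {k}

/-- The class of the virtual vector space `V₁ ⊖ V₂`. -/
noncomputable def VirtualSpace.mk (V₁ V₂ : FGModuleCat.{u} k) : VirtualSpace k :=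
  Algebra.GrothendieckAddGroup.of (VecClass.mk V₁) -
    Algebra.GrothendieckAddGroup.of (VecClass.mk V₂)

theorem grothendieck_sub_eq_sub_iff {M : Type*} [AddCommMonoid M] (a b c d : M) :
    (Algebra.GrothendieckAddGroup.of a - Algebra.GrothendieckAddGroup.of b =
      Algebra.GrothendieckAddGroup.of c - Algebra.GrothendieckAddGroup.of d) ↔
    ∃ e : M, a + d + e = c + b + e := by
  rw [sub_eq_sub_iff_add_eq_add, ← map_add, ← map_add]
  refine ((AddLocalization.addMonoidOf (⊤ : AddSubmonoid M)).eq_iff_exists).trans ?_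
  constructor
  · rintro ⟨e, he⟩
    exact ⟨e, by rw [add_comm _ (e : M), add_comm _ (e : M)]; exact he⟩
  · rintro ⟨e, he⟩
    exact ⟨⟨e, trivial⟩, by rw [add_comm _ e, add_comm _ e] at he; exact he⟩

/-- `V₁ ⊖ V₂` and `V₃ ⊖ V₄` are the same (i.e. isomorphic) as virtual vector spaces iff
`V₁ ⊕ V₄ ⊕ V₀ ≅ V₃ ⊕ V₂ ⊕ V₀` for some finite-dimensional `V₀`. -/
theorem VirtualSpace.mk_eq_mk_iff (V₁ V₂ V₃ V₄ : FGModuleCat.{u} k) :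
    VirtualSpace.mk V₁ V₂ = VirtualSpace.mk V₃ V₄ ↔
      ∃ V₀ : FGModuleCat.{u} k, Nonempty (((V₁ × V₄) × V₀) ≃ₗ[k] ((V₃ × V₂) × V₀)) := by
  refine (grothendieck_sub_eq_sub_iff _ _ _ _).trans ?_
  constructor
  · rintro ⟨⟨V₀⟩, h⟩
    exact ⟨V₀, Quotient.exact h⟩
  · rintro ⟨V₀, h⟩
    exact ⟨Quotient.mk _ V₀, Quotient.sound h⟩

/-- The isomorphism class of `V*`, additively in `V`. -/
noncomputable def VecClass.dual : VecClass k →+ VecClass k where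
  toFun := Quotient.map (fun V => FGModuleCat.of k (Module.Dual k V))
    (fun _ _ ⟨e⟩ => ⟨e.symm.dualMap⟩)
  map_zero' := Quotient.sound ⟨LinearEquiv.ofFinrankEq _ _ (by simp)⟩
  map_add' := by
    rintro ⟨V⟩ ⟨W⟩
    exact Quotient.sound ⟨(Module.dualProdDualEquivDual k V W).symm⟩

/-- The dual of a virtual vector space: `(V₁ ⊖ V₂)* = V₁* ⊖ V₂*`. -/
noncomputable def VirtualSpace.dual : VirtualSpace k →+ VirtualSpace k :=
  Algebra.GrothendieckAddGroup.lift (Algebra.GrothendieckAddGroup.of.comp VecClass.dual)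

theorem VirtualSpace.dual_mk (V₁ V₂ : FGModuleCat.{u} k) :
    VirtualSpace.dual (VirtualSpace.mk V₁ V₂) =
      VirtualSpace.mk (FGModuleCat.of k (Module.Dual k V₁))
        (FGModuleCat.of k (Module.Dual k V₂)) := by
  have h : ∀ x : VecClass k, VirtualSpace.dual (Algebra.GrothendieckAddGroup.of x) =
      Algebra.GrothendieckAddGroup.of (VecClass.dual x) := fun x =>
    DFunLike.congr_fun (Algebra.GrothendieckAddGroup.lift.symm_apply_apply
      (Algebra.GrothendieckAddGroup.of.comp VecClass.dual)) x
  rw [VirtualSpace.mk, map_sub, h, h]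
  rfl

end VirtualVectorSpaces

/-! ### `k`-diagrams -/

/-- A `k`-diagram: five vector spaces `B₁, B₂, B₃, A₁, A₂` and the four restriction maps. -/
structure KDiagram (k : Type u) [Field k] where
  B₁ : ModuleCat.{u} k
  B₂ : ModuleCat.{u} k
  B₃ : ModuleCat.{u} k
  A₁ : ModuleCat.{u} k
  A₂ : ModuleCat.{u} k
  ρ₁₁ : B₁ →ₗ[k] A₁
  ρ₂₂ : B₂ →ₗ[k] A₂
  ρ₃₁ : B₃ →ₗ[k] A₁
  ρ₃₂ : B₃ →ₗ[k] A₂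

namespace KDiagram

variable {k : Type u} [Field k]

/-- The differential
`(b₁, b₂, b₃) ↦ (ρ₁₁ b₁ - ρ₃₁ b₃, ρ₂₂ b₂ - ρ₃₂ b₃)`. -/
def differential (F : KDiagram k) : (F.B₁ × F.B₂ × F.B₃) →ₗ[k] (F.A₁ × F.A₂) where
  toFun b := (F.ρ₁₁ b.1 - F.ρ₃₁ b.2.2, F.ρ₂₂ b.2.1 - F.ρ₃₂ b.2.2)
  map_add' x y := by
    ext <;> simp <;> abel
  map_smul' c x := by
    ext <;> simp [smul_sub]

/-- The cohomology groups: `H⁰` is the kernel and `H¹` the cokernel of the differential. -/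
def H (F : KDiagram k) : Fin 2 → ModuleCat.{u} k
  | 0 => ModuleCat.of k (LinearMap.ker F.differential)
  | 1 => ModuleCat.of k ((F.A₁ × F.A₂) ⧸ LinearMap.range F.differential)

/-- Both Betti numbers are finite. -/
def IsFredholm (F : KDiagram k) : Prop := ∀ i, Module.Finite k (F.H i)

/-- Isomorphisms of `k`-diagrams. -/
structure Iso (F G : KDiagram k) where
  b₁ : F.B₁ ≃ₗ[k] G.B₁
  b₂ : F.B₂ ≃ₗ[k] G.B₂
  b₃ : F.B₃ ≃ₗ[k] G.B₃
  a₁ : F.A₁ ≃ₗ[k] G.A₁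
  a₂ : F.A₂ ≃ₗ[k] G.A₂
  comm₁₁ : ∀ x, G.ρ₁₁ (b₁ x) = a₁ (F.ρ₁₁ x)
  comm₂₂ : ∀ x, G.ρ₂₂ (b₂ x) = a₂ (F.ρ₂₂ x)
  comm₃₁ : ∀ x, G.ρ₃₁ (b₃ x) = a₁ (F.ρ₃₁ x)
  comm₃₂ : ∀ x, G.ρ₃₂ (b₃ x) = a₂ (F.ρ₃₂ x)

/-- The zero diagram. -/
def zero (k : Type u) [Field k] : KDiagram k where
  B₁ := ModuleCat.of k PUnit
  B₂ := ModuleCat.of k PUnit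
  B₃ := ModuleCat.of k PUnit
  A₁ := ModuleCat.of k PUnit
  A₂ := ModuleCat.of k PUnit
  ρ₁₁ := 0
  ρ₂₂ := 0
  ρ₃₁ := 0
  ρ₃₂ := 0

/-- The direct sum of two diagrams. -/
def sum (F G : KDiagram k) : KDiagram k where
  B₁ := ModuleCat.of k (F.B₁ × G.B₁)
  B₂ := ModuleCat.of k (F.B₂ × G.B₂)
  B₃ := ModuleCat.of k (F.B₃ × G.B₃)
  A₁ := ModuleCat.of k (F.A₁ × G.A₁)
  A₂ := ModuleCat.of k (F.A₂ × G.A₂)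
  ρ₁₁ := F.ρ₁₁.prodMap G.ρ₁₁
  ρ₂₂ := F.ρ₂₂.prodMap G.ρ₂₂
  ρ₃₁ := F.ρ₃₁.prodMap G.ρ₃₁
  ρ₃₂ := F.ρ₃₂.prodMap G.ρ₃₂

namespace Iso

def refl (F : KDiagram k) : Iso F F where
  b₁ := LinearEquiv.refl k _
  b₂ := LinearEquiv.refl k _
  b₃ := LinearEquiv.refl k _
  a₁ := LinearEquiv.refl k _
  a₂ := LinearEquiv.refl k _
  comm₁₁ _ := rfl
  comm₂₂ _ := rfl
  comm₃₁ _ := rfl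
  comm₃₂ _ := rfl

def symm {F G : KDiagram k} (e : Iso F G) : Iso G F where
  b₁ := e.b₁.symm
  b₂ := e.b₂.symm
  b₃ := e.b₃.symm
  a₁ := e.a₁.symm
  a₂ := e.a₂.symm
  comm₁₁ x := by rw [LinearEquiv.eq_symm_apply, ← e.comm₁₁, LinearEquiv.apply_symm_apply]
  comm₂₂ x := by rw [LinearEquiv.eq_symm_apply, ← e.comm₂₂, LinearEquiv.apply_symm_apply]
  comm₃₁ x := by rw [LinearEquiv.eq_symm_apply, ← e.comm₃₁, LinearEquiv.apply_symm_apply]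
  comm₃₂ x := by rw [LinearEquiv.eq_symm_apply, ← e.comm₃₂, LinearEquiv.apply_symm_apply]

def trans {F G K : KDiagram k} (e : Iso F G) (e' : Iso G K) : Iso F K where
  b₁ := e.b₁.trans e'.b₁
  b₂ := e.b₂.trans e'.b₂
  b₃ := e.b₃.trans e'.b₃
  a₁ := e.a₁.trans e'.a₁
  a₂ := e.a₂.trans e'.a₂
  comm₁₁ x := by simp [e'.comm₁₁, e.comm₁₁]
  comm₂₂ x := by simp [e'.comm₂₂, e.comm₂₂]
  comm₃₁ x := by simp [e'.comm₃₁, e.comm₃₁]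
  comm₃₂ x := by simp [e'.comm₃₂, e.comm₃₂]

def sumCongr {F G F' G' : KDiagram k} (e : Iso F G) (e' : Iso F' G') :
    Iso (F.sum F') (G.sum G') where
  b₁ := e.b₁.prodCongr e'.b₁
  b₂ := e.b₂.prodCongr e'.b₂
  b₃ := e.b₃.prodCongr e'.b₃
  a₁ := e.a₁.prodCongr e'.a₁
  a₂ := e.a₂.prodCongr e'.a₂
  comm₁₁ x := Prod.ext (e.comm₁₁ x.1) (e'.comm₁₁ x.2)
  comm₂₂ x := Prod.ext (e.comm₂₂ x.1) (e'.comm₂₂ x.2)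
  comm₃₁ x := Prod.ext (e.comm₃₁ x.1) (e'.comm₃₁ x.2)
  comm₃₂ x := Prod.ext (e.comm₃₂ x.1) (e'.comm₃₂ x.2)

def sumAssoc (F G K : KDiagram k) : Iso ((F.sum G).sum K) (F.sum (G.sum K)) where
  b₁ := LinearEquiv.prodAssoc k _ _ _
  b₂ := LinearEquiv.prodAssoc k _ _ _
  b₃ := LinearEquiv.prodAssoc k _ _ _
  a₁ := LinearEquiv.prodAssoc k _ _ _
  a₂ := LinearEquiv.prodAssoc k _ _ _
  comm₁₁ _ := rfl
  comm₂₂ _ := rfl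
  comm₃₁ _ := rfl
  comm₃₂ _ := rfl

def sumComm (F G : KDiagram k) : Iso (F.sum G) (G.sum F) where
  b₁ := LinearEquiv.prodComm k _ _
  b₂ := LinearEquiv.prodComm k _ _
  b₃ := LinearEquiv.prodComm k _ _
  a₁ := LinearEquiv.prodComm k _ _
  a₂ := LinearEquiv.prodComm k _ _
  comm₁₁ _ := rfl
  comm₂₂ _ := rfl
  comm₃₁ _ := rfl
  comm₃₂ _ := rfl

def sumZero (F : KDiagram k) : Iso (F.sum (zero k)) F where
  b₁ := LinearEquiv.prodUnique (R := k) (M := F.B₁) (M₂ := PUnit.{u + 1})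
  b₂ := LinearEquiv.prodUnique (R := k) (M := F.B₂) (M₂ := PUnit.{u + 1})
  b₃ := LinearEquiv.prodUnique (R := k) (M := F.B₃) (M₂ := PUnit.{u + 1})
  a₁ := LinearEquiv.prodUnique (R := k) (M := F.A₁) (M₂ := PUnit.{u + 1})
  a₂ := LinearEquiv.prodUnique (R := k) (M := F.A₂) (M₂ := PUnit.{u + 1})
  comm₁₁ _ := rfl
  comm₂₂ _ := rfl
  comm₃₁ _ := rfl
  comm₃₂ _ := rfl

end Iso

theorem nonempty_H_equiv_of_iso {F G : KDiagram k} (e : Iso F G) (i : Fin 2) :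
    Nonempty (F.H i ≃ₗ[k] G.H i) := by
  have hc : ∀ x, G.differential ((e.b₁.prodCongr (e.b₂.prodCongr e.b₃)) x) =
      (e.a₁.prodCongr e.a₂) (F.differential x) := fun x => by
    ext <;> simp [differential, e.comm₁₁, e.comm₂₂, e.comm₃₁, e.comm₃₂]
  match i with
  | 0 =>
    refine ⟨LinearEquiv.ofSubmodules (e.b₁.prodCongr (e.b₂.prodCongr e.b₃))
      (LinearMap.ker F.differential) (LinearMap.ker G.differential) ?_⟩
    ext y
    rw [Submodule.mem_map]
    constructor
    · rintro ⟨x, hx, rfl⟩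
      have hx' : F.differential x = 0 := hx
      exact (hc x).trans (by rw [hx', map_zero])
    · intro hy
      obtain ⟨x, rfl⟩ := (e.b₁.prodCongr (e.b₂.prodCongr e.b₃)).surjective y
      refine ⟨x, ?_, rfl⟩
      have hy' : (e.a₁.prodCongr e.a₂) (F.differential x) = 0 := (hc x).symm.trans hy
      exact (LinearEquiv.map_eq_zero_iff _).1 hy'
  | 1 =>
    refine ⟨Submodule.Quotient.equiv (LinearMap.range F.differential)
      (LinearMap.range G.differential) (e.a₁.prodCongr e.a₂) ?_⟩
    ext y
    rw [Submodule.mem_map]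
    constructor
    · rintro ⟨_, ⟨x, rfl⟩, rfl⟩
      exact ⟨_, hc x⟩
    · rintro ⟨x, rfl⟩
      obtain ⟨x, rfl⟩ := (e.b₁.prodCongr (e.b₂.prodCongr e.b₃)).surjective x
      exact ⟨_, ⟨x, rfl⟩, (hc x).symm⟩

theorem nonempty_H_sum_equiv (F G : KDiagram k) (i : Fin 2) :
    Nonempty ((F.sum G).H i ≃ₗ[k] (F.H i × G.H i)) := by
  match i with
  | 0 =>
    refine ⟨LinearEquiv.symm (LinearEquiv.ofBijective
      (M := LinearMap.ker F.differential × LinearMap.ker G.differential)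
      (M₂ := LinearMap.ker (F.sum G).differential)
      { toFun := fun p => ⟨((p.1.1.1, p.2.1.1), (p.1.1.2.1, p.2.1.2.1), (p.1.1.2.2, p.2.1.2.2)), by
          have h₁ : F.differential p.1.1 = 0 := p.1.2
          have h₂ : G.differential p.2.1 = 0 := p.2.2
          exact Prod.ext (Prod.ext ((congrArg Prod.fst h₁ :)) ((congrArg Prod.fst h₂ :)))
            (Prod.ext ((congrArg Prod.snd h₁ :)) ((congrArg Prod.snd h₂ :)))⟩
        map_add' := fun _ _ => rfl
        map_smul' := fun _ _ => rfl } ⟨?_, ?_⟩)⟩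
    · rintro ⟨⟨⟨x1, x2, x3⟩, hx⟩, ⟨⟨y1, y2, y3⟩, hy⟩⟩ ⟨⟨⟨u1, u2, u3⟩, hu⟩, ⟨⟨v1, v2, v3⟩, hv⟩⟩ h
      have h' := congrArg Subtype.val h
      have e₁ : x1 = u1 := congrArg (fun z => z.1.1) h'
      have e₂ : y1 = v1 := congrArg (fun z => z.1.2) h'
      have e₃ : x2 = u2 := congrArg (fun z => z.2.1.1) h'
      have e₄ : y2 = v2 := congrArg (fun z => z.2.1.2) h'
      have e₅ : x3 = u3 := congrArg (fun z => z.2.2.1) h'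
      have e₆ : y3 = v3 := congrArg (fun z => z.2.2.2) h'
      subst e₁ e₂ e₃ e₄ e₅ e₆
      rfl
    · rintro ⟨⟨⟨x1, y1⟩, ⟨x2, y2⟩, ⟨x3, y3⟩⟩, h⟩
      have h' : (F.sum G).differential ((x1, y1), (x2, y2), (x3, y3)) = 0 := h
      have e₁ := congrArg (fun z => z.1.1) h'
      have e₂ := congrArg (fun z => z.1.2) h'
      have e₃ := congrArg (fun z => z.2.1) h'
      have e₄ := congrArg (fun z => z.2.2) h'
      exact ⟨⟨⟨(x1, x2, x3), Prod.ext e₁ e₃⟩, ⟨(y1, y2, y3), Prod.ext e₂ e₄⟩⟩, rfl⟩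
  | 1 =>
    let q : ((F.A₁ × G.A₁) × (F.A₂ × G.A₂)) →ₗ[k]
        (((F.A₁ × F.A₂) ⧸ LinearMap.range F.differential) ×
          ((G.A₁ × G.A₂) ⧸ LinearMap.range G.differential)) :=
      { toFun := fun p => (Submodule.Quotient.mk (p.1.1, p.2.1),
          Submodule.Quotient.mk (p.1.2, p.2.2))
        map_add' := fun _ _ => rfl
        map_smul' := fun _ _ => rfl }
    have hq : LinearMap.range (F.sum G).differential = LinearMap.ker q := by
      ext ⟨⟨x1, y1⟩, ⟨x2, y2⟩⟩
      constructor
      · rintro ⟨⟨⟨u1, v1⟩, ⟨u2, v2⟩, ⟨u3, v3⟩⟩, h⟩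
        have e₁ : F.ρ₁₁ u1 - F.ρ₃₁ u3 = x1 := congrArg (fun z => z.1.1) h
        have e₂ : G.ρ₁₁ v1 - G.ρ₃₁ v3 = y1 := congrArg (fun z => z.1.2) h
        have e₃ : F.ρ₂₂ u2 - F.ρ₃₂ u3 = x2 := congrArg (fun z => z.2.1) h
        have e₄ : G.ρ₂₂ v2 - G.ρ₃₂ v3 = y2 := congrArg (fun z => z.2.2) h
        refine Prod.ext ((Submodule.Quotient.mk_eq_zero _).2 ⟨(u1, u2, u3), Prod.ext e₁ e₃⟩)
          ((Submodule.Quotient.mk_eq_zero _).2 ⟨(v1, v2, v3), Prod.ext e₂ e₄⟩)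
      · intro h
        have h' : q ((x1, y1), (x2, y2)) = 0 := h
        obtain ⟨⟨u1, u2, u3⟩, hu⟩ :=
          (Submodule.Quotient.mk_eq_zero _).1 (congrArg Prod.fst h')
        obtain ⟨⟨v1, v2, v3⟩, hv⟩ :=
          (Submodule.Quotient.mk_eq_zero _).1 (congrArg Prod.snd h')
        exact ⟨((u1, v1), (u2, v2), (u3, v3)),
          Prod.ext (Prod.ext ((congrArg Prod.fst hu :)) ((congrArg Prod.fst hv :)))
            (Prod.ext ((congrArg Prod.snd hu :)) ((congrArg Prod.snd hv :)))⟩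
    have hs : Function.Surjective q := by
      rintro ⟨x, y⟩
      obtain ⟨⟨x1, x2⟩, rfl⟩ := Submodule.Quotient.mk_surjective _ x
      obtain ⟨⟨y1, y2⟩, rfl⟩ := Submodule.Quotient.mk_surjective _ y
      exact ⟨((x1, y1), (x2, y2)), rfl⟩
    exact ⟨(Submodule.quotEquivOfEq (LinearMap.range (F.sum G).differential) (LinearMap.ker q)
      hq).trans (q.quotKerEquivOfSurjective hs)⟩

theorem IsFredholm.sum {F G : KDiagram k} (hF : F.IsFredholm) (hG : G.IsFredholm) :
    (F.sum G).IsFredholm := fun i => by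
  obtain ⟨e⟩ := nonempty_H_sum_equiv F G i
  have := hF i
  have := hG i
  exact Module.Finite.equiv e.symm

theorem subsingleton_H_zero (i : Fin 2) : Subsingleton ((zero k).H i) := by
  match i with
  | 0 =>
    change Subsingleton (LinearMap.ker (zero k).differential)
    exact ⟨fun _ _ => Subtype.ext (Prod.ext (Subsingleton.elim (α := PUnit) _ _)
      (Prod.ext (Subsingleton.elim (α := PUnit) _ _) (Subsingleton.elim (α := PUnit) _ _)))⟩
  | 1 =>
    refine ⟨fun x y => ?_⟩
    obtain ⟨x, rfl⟩ := Submodule.Quotient.mk_surjective _ x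
    obtain ⟨y, rfl⟩ := Submodule.Quotient.mk_surjective _ y
    exact congrArg _ (Prod.ext (Subsingleton.elim (α := PUnit) _ _)
      (Subsingleton.elim (α := PUnit) _ _))

theorem isFredholm_zero : (zero k).IsFredholm := fun i => by
  have := subsingleton_H_zero (k := k) i
  infer_instance

end KDiagram

/-! ### Virtual (Fredholm) `k`-diagrams -/

section VirtualDiagrams

variable (k : Type u) [Field k]

/-- Fredholm `k`-diagrams: `k`-diagrams with finite Betti numbers. -/
def FredholmDiagram : Type (u + 1) := {F : KDiagram k // F.IsFredholm}

instance diagramSetoid : Setoid (FredholmDiagram k) where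
  r F G := Nonempty (KDiagram.Iso F.1 G.1)
  iseqv :=
    { refl := fun F => ⟨KDiagram.Iso.refl F.1⟩
      symm := fun ⟨e⟩ => ⟨e.symm⟩
      trans := fun ⟨e⟩ ⟨e'⟩ => ⟨e.trans e'⟩ }

/-- Isomorphism classes of Fredholm `k`-diagrams. -/
def DiagramClass : Type (u + 1) := Quotient (diagramSetoid k)

/-- Addition is direct sum. -/
instance : Add (DiagramClass k) where
  add := Quotient.map₂ (fun F G => (⟨F.1.sum G.1, F.2.sum G.2⟩ : FredholmDiagram k))
    (fun _ _ ⟨e⟩ _ _ ⟨e'⟩ => ⟨e.sumCongr e'⟩)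

instance : Zero (DiagramClass k) where
  zero := Quotient.mk _ ⟨KDiagram.zero k, KDiagram.isFredholm_zero⟩

instance : AddCommMonoid (DiagramClass k) where
  add_assoc := by
    rintro ⟨F⟩ ⟨G⟩ ⟨K⟩
    exact Quotient.sound ⟨KDiagram.Iso.sumAssoc F.1 G.1 K.1⟩
  zero_add := by
    rintro ⟨F⟩
    exact Quotient.sound ⟨(KDiagram.Iso.sumComm _ _).trans (KDiagram.Iso.sumZero F.1)⟩
  add_zero := by
    rintro ⟨F⟩
    exact Quotient.sound ⟨KDiagram.Iso.sumZero F.1⟩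
  add_comm := by
    rintro ⟨F⟩ ⟨G⟩
    exact Quotient.sound ⟨KDiagram.Iso.sumComm F.1 G.1⟩
  nsmul := nsmulRec

/-- Equivalence classes of virtual (Fredholm) `k`-diagrams `F₁ ⊖ F₂`, where `F₁ ⊖ F₂ ∼ F₃ ⊖ F₄`
iff `F₁ ⊕ F₄ ⊕ F₀ ≅ F₃ ⊕ F₂ ⊕ F₀` for some Fredholm `k`-diagram `F₀`. -/
abbrev VirtualDiagram : Type (u + 1) := Algebra.GrothendieckAddGroup (DiagramClass k)

variable {k}

/-- The isomorphism class of `Hⁱ(F)`, additively in `F`. -/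
noncomputable def DiagramClass.H (i : Fin 2) : DiagramClass k →+ VecClass k where
  toFun := Quotient.map (fun F => (⟨F.1.H i, F.2 i⟩ : FGModuleCat.{u} k))
    (fun _ _ ⟨e⟩ => KDiagram.nonempty_H_equiv_of_iso e i)
  map_zero' := Quotient.sound (by
    have := KDiagram.subsingleton_H_zero (k := k) i
    exact ⟨{ toFun := fun _ => PUnit.unit, invFun := fun _ => 0, map_add' := fun _ _ => rfl,
             map_smul' := fun _ _ => rfl, left_inv := fun _ => Subsingleton.elim _ _,
             right_inv := fun _ => rfl }⟩)
  map_add' := by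
    rintro ⟨F⟩ ⟨G⟩
    exact Quotient.sound (KDiagram.nonempty_H_sum_equiv F.1 G.1 i)

/-- The cohomology of a virtual diagram: `Hⁱ(F₁ ⊖ F₂) = Hⁱ(F₁) ⊖ Hⁱ(F₂)`. -/
noncomputable def VirtualDiagram.H (i : Fin 2) : VirtualDiagram k →+ VirtualSpace k :=
  Algebra.GrothendieckAddGroup.lift (Algebra.GrothendieckAddGroup.of.comp (DiagramClass.H i))

end VirtualDiagrams

/-! ### The diagrams `M_{W,d}` -/

/-- The multiset on `ℤ × ℤ` with multiplicities `W` (for `W ≥ 0`): `W a` copies of each `a`. -/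
abbrev Multi (W : ℤ × ℤ → ℤ) : Type := {p : (ℤ × ℤ) × ℕ // 1 ≤ p.2 ∧ (p.2 : ℤ) ≤ W p.1}

/-- The `k`-diagram `M_{W,d}` (for `W ≥ 0`): `B_i = k^{⊕ ℤ_{≤ d_i}}` and `A_i = k^{⊕ ℤ}` with the
inclusions as restriction maps, `B₃ = k^{⊕ W}` with the two projections. -/
noncomputable def diagramM (k : Type u) [Field k] (W : ℤ × ℤ → ℤ) (d : ℤ × ℤ) : KDiagram k where
  B₁ := ModuleCat.of k ({n : ℤ // n ≤ d.1} →₀ k)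
  B₂ := ModuleCat.of k ({n : ℤ // n ≤ d.2} →₀ k)
  B₃ := ModuleCat.of k (Multi W →₀ k)
  A₁ := ModuleCat.of k (ℤ →₀ k)
  A₂ := ModuleCat.of k (ℤ →₀ k)
  ρ₁₁ := Finsupp.lmapDomain k k (fun n => n.1)
  ρ₂₂ := Finsupp.lmapDomain k k (fun n => n.1)
  ρ₃₁ := Finsupp.lmapDomain k k (fun p => p.1.1.1)
  ρ₃₂ := Finsupp.lmapDomain k k (fun p => p.1.1.2)

section Fredholm

variable {k : Type u} [Field k] {W : ℤ × ℤ → ℤ}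

theorem finite_H_zero_diagramM (d : ℤ × ℤ) (h₁ : Function.Injective fun p : Multi W => p.1.1.1)
    (h₂ : Function.Injective fun p : Multi W => p.1.1.2)
    (hfin : Finite {p : Multi W // p.1.1 ≤ d}) :
    Module.Finite k (LinearMap.ker (diagramM k W d).differential) := by
  let φ : LinearMap.ker (diagramM k W d).differential →ₗ[k] ({p : Multi W // p.1.1 ≤ d} → k) :=
    { toFun := fun b p => (show Multi W →₀ k from b.1.2.2) p.1
      map_add' := fun _ _ => rfl
      map_smul' := fun _ _ => rfl }
  refine Module.Finite.of_injective φ ((injective_iff_map_eq_zero φ).2 ?_)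
  rintro ⟨⟨(b₁ : {n : ℤ // n ≤ d.1} →₀ k), (b₂ : {n : ℤ // n ≤ d.2} →₀ k),
    (b₃ : Multi W →₀ k)⟩, hb⟩ h0
  have e₁ : Finsupp.mapDomain (fun n : {n : ℤ // n ≤ d.1} => n.1) b₁ =
      Finsupp.mapDomain (fun p : Multi W => p.1.1.1) b₃ := sub_eq_zero.1 (congrArg Prod.fst hb :)
  have e₂ : Finsupp.mapDomain (fun n : {n : ℤ // n ≤ d.2} => n.1) b₂ =
      Finsupp.mapDomain (fun p : Multi W => p.1.1.2) b₃ := sub_eq_zero.1 (congrArg Prod.snd hb :)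
  have h3 : b₃ = 0 := by
    ext p
    by_cases hp : p.1.1 ≤ d
    · exact congrFun h0 ⟨p, hp⟩
    · rw [Finsupp.coe_zero, Pi.zero_apply]
      by_cases hp1 : p.1.1.1 ≤ d.1
      · have hp2 : ¬ p.1.1.2 ≤ d.2 := fun h => hp ⟨hp1, h⟩
        rw [← Finsupp.mapDomain_apply h₂ b₃ p, ← e₂]
        exact Finsupp.mapDomain_of_notMem_range _ _ (by rintro ⟨n, hn⟩; exact hp2 (hn ▸ n.2))
      · rw [← Finsupp.mapDomain_apply h₁ b₃ p, ← e₁]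
        exact Finsupp.mapDomain_of_notMem_range _ _ (by rintro ⟨n, hn⟩; exact hp1 (hn ▸ n.2))
  subst h3
  rw [Finsupp.mapDomain_zero, ← Finsupp.mapDomain_zero] at e₁ e₂
  have h4 := Finsupp.mapDomain_injective Subtype.val_injective e₁
  have h5 := Finsupp.mapDomain_injective Subtype.val_injective e₂
  subst h4 h5
  rfl

theorem finite_H_one_diagramM (d : ℤ × ℤ) (h₁ : Function.Surjective fun p : Multi W => p.1.1.1)
    (h₂ : Function.Surjective fun p : Multi W => p.1.1.2)
    (hfin : Finite {p : Multi W // d + 1 ≤ p.1.1}) :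
    Module.Finite k (((ℤ →₀ k) × (ℤ →₀ k)) ⧸
      (show Submodule k ((ℤ →₀ k) × (ℤ →₀ k)) from
        LinearMap.range (diagramM k W d).differential)) := by
  let R : Submodule k ((ℤ →₀ k) × (ℤ →₀ k)) := LinearMap.range (diagramM k W d).differential
  change Module.Finite k (_ ⧸ R)
  let ψ : ({p : Multi W // d + 1 ≤ p.1.1} →₀ k) →ₗ[k] ((ℤ →₀ k) × (ℤ →₀ k)) ⧸ R :=
    R.mkQ ∘ₗ LinearMap.inl k _ _ ∘ₗ Finsupp.lmapDomain k k (fun p => p.1.1.1.1)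
  have key : ∀ (p : Multi W) (c : k),
      R.mkQ (Finsupp.single p.1.1.1 c, 0) = - R.mkQ (0, Finsupp.single p.1.1.2 c) := by
    intro p c
    rw [eq_neg_iff_add_eq_zero, ← map_add, Submodule.mkQ_apply, Submodule.Quotient.mk_eq_zero]
    refine ⟨(0, 0, (show Multi W →₀ k from - Finsupp.single p c)), ?_⟩
    change ((Finsupp.lmapDomain k k _ 0 - Finsupp.lmapDomain k k _ (- Finsupp.single p c) : ℤ →₀ k),
      (Finsupp.lmapDomain k k _ 0 - Finsupp.lmapDomain k k _ (- Finsupp.single p c) : ℤ →₀ k)) = _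
    simp only [map_neg, map_zero, Finsupp.lmapDomain_apply, Finsupp.mapDomain_single]
    exact Prod.ext (((zero_sub _).trans (neg_neg _)).trans (add_zero _).symm)
      (((zero_sub _).trans (neg_neg _)).trans (zero_add _).symm)
  have low₁ : ∀ (n : ℤ) (c : k), n ≤ d.1 → R.mkQ (Finsupp.single n c, 0) = 0 := by
    intro n c hn
    rw [Submodule.mkQ_apply, Submodule.Quotient.mk_eq_zero]
    refine ⟨((show {n : ℤ // n ≤ d.1} →₀ k from Finsupp.single ⟨n, hn⟩ c), 0, 0), ?_⟩
    change ((Finsupp.lmapDomain k k _ (Finsupp.single _ c) - Finsupp.lmapDomain k k _ 0 : ℤ →₀ k),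
      (Finsupp.lmapDomain k k _ 0 - Finsupp.lmapDomain k k _ 0 : ℤ →₀ k)) = _
    simp only [map_zero, Finsupp.lmapDomain_apply, Finsupp.mapDomain_single]
    exact Prod.ext (sub_zero _) (sub_zero _)
  have low₂ : ∀ (n : ℤ) (c : k), n ≤ d.2 → R.mkQ (0, Finsupp.single n c) = 0 := by
    intro n c hn
    rw [Submodule.mkQ_apply, Submodule.Quotient.mk_eq_zero]
    refine ⟨(0, (show {n : ℤ // n ≤ d.2} →₀ k from Finsupp.single ⟨n, hn⟩ c), 0), ?_⟩
    change ((Finsupp.lmapDomain k k _ 0 - Finsupp.lmapDomain k k _ 0 : ℤ →₀ k),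
      (Finsupp.lmapDomain k k _ (Finsupp.single _ c) - Finsupp.lmapDomain k k _ 0 : ℤ →₀ k)) = _
    simp only [map_zero, Finsupp.lmapDomain_apply, Finsupp.mapDomain_single]
    exact Prod.ext (sub_zero _) (sub_zero _)
  have g : ∀ (p : Multi W) (c : k), R.mkQ (Finsupp.single p.1.1.1 c, 0) ∈ LinearMap.range ψ := by
    intro p c
    by_cases hp : d + 1 ≤ p.1.1
    · exact ⟨Finsupp.single ⟨p, hp⟩ c, by simp [ψ]⟩
    · have : p.1.1.1 ≤ d.1 ∨ p.1.1.2 ≤ d.2 := by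
        by_contra! h
        exact hp ⟨Int.add_one_le_iff.2 h.1, Int.add_one_le_iff.2 h.2⟩
      rcases this with h | h
      · rw [low₁ _ _ h]
        exact zero_mem _
      · rw [key, low₂ _ _ h, neg_zero]
        exact zero_mem _
  have g₁ : ∀ x : ℤ →₀ k, R.mkQ (x, 0) ∈ LinearMap.range ψ := by
    intro x
    induction x using Finsupp.induction_linear with
    | zero => exact (map_zero R.mkQ).symm ▸ zero_mem _
    | add x y hx hy =>
      have e : R.mkQ (x + y, 0) = R.mkQ (x, 0) + R.mkQ (y, 0) := by
        rw [← map_add, Prod.mk_add_mk, add_zero]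
      exact e ▸ add_mem hx hy
    | single n c =>
      obtain ⟨p, rfl⟩ := h₁ n
      exact g p c
  have g₂ : ∀ x : ℤ →₀ k, R.mkQ (0, x) ∈ LinearMap.range ψ := by
    intro x
    induction x using Finsupp.induction_linear with
    | zero => exact (map_zero R.mkQ).symm ▸ zero_mem _
    | add x y hx hy =>
      have e : R.mkQ (0, x + y) = R.mkQ (0, x) + R.mkQ (0, y) := by
        rw [← map_add, Prod.mk_add_mk, add_zero]
      exact e ▸ add_mem hx hy
    | single n c =>
      obtain ⟨p, rfl⟩ := h₂ n
      have := neg_mem (g p c)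
      rwa [key, neg_neg] at this
  refine Module.Finite.of_surjective ψ fun y => ?_
  obtain ⟨⟨x₁, x₂⟩, rfl⟩ := Submodule.mkQ_surjective R y
  have e : R.mkQ (x₁, x₂) = R.mkQ (x₁, 0) + R.mkQ (0, x₂) := by
    rw [← map_add, Prod.mk_add_mk, add_zero, zero_add]
  exact e ▸ add_mem (g₁ x₁) (g₂ x₂)

theorem IsPerfectMatching.isFredholm_diagramM (hW : IsPerfectMatching W) (d : ℤ × ℤ) :
    (diagramM k W d).IsFredholm := by
  obtain ⟨⟨a, ha⟩, ⟨b, hb⟩, π, hπ⟩ := hW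
  have hp : ∀ p : Multi W, p.1.1.2 = π p.1.1.1 ∧ p.1.2 = 1 := by
    rintro ⟨⟨⟨i, j⟩, m⟩, h1, h2⟩
    have h3 := hπ i j
    simp only at h1 h2 ⊢
    rw [h3] at h2
    split_ifs at h2 with h
    · exact ⟨h, by omega⟩
    · omega
  have hval : ∀ p : Multi W, W p.1.1 ≠ 0 := fun p h => by
    have h1 := p.2.1
    have h2 := p.2.2
    omega
  have inj₁ : Function.Injective fun p : Multi W => p.1.1.1 := by
    intro p q h
    have h' : p.1.1.1 = q.1.1.1 := h
    exact Subtype.ext (Prod.ext (Prod.ext h' (by rw [(hp p).1, (hp q).1, h']))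
      (by rw [(hp p).2, (hp q).2]))
  have inj₂ : Function.Injective fun p : Multi W => p.1.1.2 := by
    intro p q h
    have h' : p.1.1.2 = q.1.1.2 := h
    rw [(hp p).1, (hp q).1] at h'
    exact inj₁ (π.injective h')
  have surj₁ : Function.Surjective fun p : Multi W => p.1.1.1 := fun n =>
    ⟨⟨((n, π n), 1), le_refl _, by simp [hπ]⟩, rfl⟩
  have surj₂ : Function.Surjective fun p : Multi W => p.1.1.2 := fun n =>
    ⟨⟨((π.symm n, n), 1), le_refl _, by simp [hπ]⟩, rfl⟩
  intro i
  match i with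
  | 0 =>
    refine finite_H_zero_diagramM d inj₁ inj₂ ?_
    refine Finite.of_injective
      (fun p : {p : Multi W // p.1.1 ≤ d} => (⟨p.1.1.1.1, ?_⟩ : Set.Icc (a - d.2) d.1))
      (fun p q h => Subtype.ext (inj₁ (congrArg Subtype.val h)))
    have h1 : ¬ deg p.1.1.1 ≤ a := fun h => hval p.1 (ha _ h)
    have h2 := p.2.1
    have h3 := p.2.2
    unfold deg at h1
    exact ⟨by omega, h2⟩
  | 1 =>
    refine finite_H_one_diagramM d surj₁ surj₂ ?_
    refine Finite.of_injective
      (fun p : {p : Multi W // d + 1 ≤ p.1.1} => (⟨p.1.1.1.1, ?_⟩ : Set.Icc d.1 (b - d.2)))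
      (fun p q h => Subtype.ext (inj₁ (congrArg Subtype.val h)))
    have h1 : ¬ b ≤ deg p.1.1.1 := fun h => hval p.1 (hb _ h)
    have h2 : d.1 + 1 ≤ p.1.1.1.1 := p.2.1
    have h3 : d.2 + 1 ≤ p.1.1.1.2 := p.2.2
    unfold deg at h1
    exact ⟨by omega, by omega⟩

end Fredholm

/-- The diagram `M_{W,d}` of a perfect matching `W`, up to isomorphism of Fredholm diagrams. -/
noncomputable def matchingClass (k : Type u) [Field k] {W : ℤ × ℤ → ℤ} (hW : IsPerfectMatching W)
    (d : ℤ × ℤ) : DiagramClass k :=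
  Quotient.mk (diagramSetoid k) ⟨diagramM k W d, hW.isFredholm_diagramM d⟩

/-- The class `[M_{W,d}]` of the virtual `k`-diagram
`(M_{W₁,d} ⊕ ⋯ ⊕ M_{W_{s+1},d}) ⊖ (M_{W̃₁,d} ⊕ ⋯ ⊕ M_{W̃_s,d})`,
for a given way of writing `W = (W₁ + ⋯ + W_{s+1}) - (W̃₁ + ⋯ + W̃_s)`. -/
noncomputable def MatchingDecomposition.virtualDiagram (k : Type u) [Field k] {W : ℤ × ℤ → ℤ}
    (D : MatchingDecomposition W) (d : ℤ × ℤ) : VirtualDiagram k :=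
  Algebra.GrothendieckAddGroup.of (∑ i, matchingClass k (D.pos_perfect i) d) -
    Algebra.GrothendieckAddGroup.of (∑ j, matchingClass k (D.neg_perfect j) d)

end RiemannDuality

namespace RiemannDuality

/-! ### Regular locally finite matrices are sums of permutation matrices -/

section Regular

variable {α β : Type*} {A : α → β → ℕ} {m : ℕ}

/-! A virtual finite-dimensional space is determined by its integer dimension, and dualizing
preserves that integer, so the duality is a numerical statement. For one perfect matching `W`, each
point `(i, j)` of its graph contributes separately to the cohomology of `M_{W,d}`: a class in `H⁰`
if `i ≤ d.1` and `j ≤ d.2`, a class in `H¹` if both inequalities fail, and nothing otherwise. Hence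
`h⁰` and `h¹` are the sums of `W` over `a ≤ d` and over `a ≥ d + 1` (`IsPerfectMatching.finrank_H`).
By additivity the same formulas hold for any decomposition of a general `W`, so they do not depend
on the decomposition (`MatchingDecomposition.dim_H_virtualDiagram`). The reflection `a ↦ K + 1 - a`
interchanges the two kinds of region, with `K - d` in place of `d`, and carries `W` to its dual
weight (`finsum_bettiRegion_dualWeight`).

For existence, asymptotic linearity of the Riemann function makes `W` eventually zero with all row
and column sums `1`. If `|W| ≤ C`, adding `C` on the diagonal band containing the support of `W`
gives a nonnegative banded matrix with constant line sums, and the added band is another such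
matrix. Each is a finite sum of permutation matrices by Hall's theorem and Schröder–Bernstein, and
their difference is `W`. Reflecting every matching decomposes the dual weight. Boundedness is needed
only for this existence part. -/

theorem exists_injective_of_regular (hr : ∀ i, (Function.support (A i)).Finite)
    (hc : ∀ j, (Function.support fun i => A i j).Finite) (hm : m ≠ 0)
    (hrow : ∀ i, ∑ᶠ j, A i j = m) (hcol : ∀ j, ∑ᶠ i, A i j = m) :
    ∃ g : α → β, Function.Injective g ∧ ∀ i, A i (g i) ≠ 0 := by
  classical
  have key := (Finset.all_card_le_biUnion_card_iff_exists_injective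
    (fun i => (hr i).toFinset)).1 fun S => by
    set T := S.biUnion fun i => (hr i).toFinset with hT
    -- Hall's condition by double counting: the rows in `S` have total weight `|S| * m`, all of it
    -- in the columns `T`, and each column carries at most `m`.
    refine Nat.le_of_mul_le_mul_right ?_ (Nat.pos_of_ne_zero hm)
    calc S.card * m = ∑ i ∈ S, ∑ᶠ j, A i j := by simp [hrow]
      _ = ∑ i ∈ S, ∑ j ∈ T, A i j := by
        refine Finset.sum_congr rfl fun i hi => finsum_eq_sum_of_support_subset _ fun j hj => ?_
        rw [hT, Finset.mem_coe, Finset.mem_biUnion]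
        exact ⟨i, hi, (hr i).mem_toFinset.2 hj⟩
      _ = ∑ j ∈ T, ∑ i ∈ S, A i j := Finset.sum_comm
      _ ≤ ∑ _j ∈ T, m := by
        refine Finset.sum_le_sum fun j _ => ?_
        rw [← hcol j, finsum_eq_sum _ (hc j)]
        exact Finset.sum_le_sum_of_ne_zero fun i _ hi => (hc j).mem_toFinset.2 hi
      _ = T.card * m := by simp
  obtain ⟨g, hg, h⟩ := key
  exact ⟨g, hg, fun i => (hr i).mem_toFinset.1 (h i)⟩

/-- Hall's theorem gives injections in both directions through nonzero entries. The relational form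
of Schröder–Bernstein merges them into a bijection that still uses only nonzero entries, which an
infinite index set does not give for free. -/
theorem exists_equiv_of_regular (hr : ∀ i, (Function.support (A i)).Finite)
    (hc : ∀ j, (Function.support fun i => A i j).Finite) (hm : m ≠ 0)
    (hrow : ∀ i, ∑ᶠ j, A i j = m) (hcol : ∀ j, ∑ᶠ i, A i j = m) :
    ∃ π : α ≃ β, ∀ i, A i (π i) ≠ 0 := by
  obtain ⟨g, hg, h⟩ := exists_injective_of_regular hr hc hm hrow hcol
  obtain ⟨g', hg', h'⟩ := exists_injective_of_regular (A := fun j i => A i j) hc hr hm hcol hrow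
  obtain ⟨p, hp, hA⟩ := Function.Embedding.schroeder_bernstein_of_rel hg hg'
    (fun i j => A i j ≠ 0) h h'
  exact ⟨Equiv.ofBijective p hp, hA⟩

/-- Subtracting the permutation matrix of a bijection through nonzero entries lowers every row and
column sum by one, so induction on `m` applies. -/
theorem exists_equivs_of_regular [DecidableEq β] (hr : ∀ i, (Function.support (A i)).Finite)
    (hc : ∀ j, (Function.support fun i => A i j).Finite)
    (hrow : ∀ i, ∑ᶠ j, A i j = m) (hcol : ∀ j, ∑ᶠ i, A i j = m) :
    ∃ π : Fin m → (α ≃ β), ∀ i j, A i j = ∑ n, if j = π n i then 1 else 0 := by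
  induction m generalizing A with
  | zero =>
    refine ⟨Fin.elim0, fun i j => ?_⟩
    have h := hrow i
    rw [finsum_eq_sum _ (hr i), Finset.sum_eq_zero_iff] at h
    by_contra hne
    exact hne (h j ((hr i).mem_toFinset.2 fun h0 => hne (by simpa using h0)))
  | succ m ih =>
    obtain ⟨π, hπ⟩ := exists_equiv_of_regular hr hc m.succ_ne_zero hrow hcol
    set A' : α → β → ℕ := fun i j => A i j - if j = π i then 1 else 0 with hA'
    -- Truncated subtraction loses nothing, because `A i (π i)` is at least `1`.
    have hA : ∀ i j, A i j = A' i j + if j = π i then 1 else 0 := by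
      intro i j
      simp only [hA']
      split_ifs with h
      · have := hπ i
        subst h
        omega
      · rfl
    have hr' : ∀ i, (Function.support (A' i)).Finite := fun i =>
      (hr i).subset fun j hj h0 => hj (by simp only [hA', h0, Nat.zero_sub])
    have hc' : ∀ j, (Function.support fun i => A' i j).Finite := fun j =>
      (hc j).subset fun i hi h0 => hi (by
        have h0' : A i j = 0 := h0
        simp only [hA', h0', Nat.zero_sub])
    obtain ⟨π', hπ'⟩ := ih hr' hc'
      (fun i => by
        have h := hrow i
        simp only [hA i] at h
        rw [finsum_add_distrib (hr' i) ((Set.finite_singleton (π i)).subset (by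
            intro j hj; by_contra hne; exact hj (if_neg hne))),
          finsum_eq_single _ (π i) (fun j hj => if_neg hj), if_pos rfl] at h
        omega)
      (fun j => by
        have h := hcol j
        simp only [hA _ j] at h
        rw [finsum_add_distrib (hc' j) ((Set.finite_singleton (π.symm j)).subset (by
            intro i hi; by_contra hne
            exact hi (if_neg fun e => hne (by simp [e])))),
          finsum_eq_single _ (π.symm j) (fun i hi => if_neg fun e => hi (by simp [e])),
          if_pos (by simp)] at h
        omega)
    refine ⟨Fin.cons π π', fun i j => ?_⟩
    rw [hA, hπ', Fin.sum_univ_succ, add_comm]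
    simp

end Regular

/-! ### Decomposition into perfect matchings -/

/-- An upper bound on both coordinates and a lower bound on their sum confine a point to a box. This
lets the `finsum` over `Set.Iic d` be split. -/
theorem finite_Iic_inter_support {W : ℤ × ℤ → ℤ} (hW : InitiallyZero W) (d : ℤ × ℤ) :
    (Set.Iic d ∩ Function.support W).Finite := by
  obtain ⟨a, ha⟩ := hW
  refine (Set.finite_Icc ((a - d.2, a - d.1) : ℤ × ℤ) d).subset ?_
  rintro ⟨i, j⟩ ⟨⟨h1, h2⟩, h3⟩
  have h4 : ¬ deg (i, j) ≤ a := fun h => h3 (ha _ h)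
  simp only [deg] at h1 h2 h4
  exact ⟨⟨by simp only; omega, by simp only; omega⟩, h1, h2⟩

theorem support_row_subset {W : ℤ × ℤ → ℤ} {a b : ℤ} (ha : ∀ d, deg d ≤ a → W d = 0)
    (hb : ∀ d, b ≤ deg d → W d = 0) (i : ℤ) :
    (Function.support fun j => W (i, j)) ⊆ Finset.Ioo (a - i) (b - i) := by
  intro j hj
  have h1 : ¬ deg (i, j) ≤ a := fun h => hj (ha _ h)
  have h2 : ¬ b ≤ deg (i, j) := fun h => hj (hb _ h)
  simp only [deg] at h1 h2
  rw [Finset.coe_Ioo]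
  exact ⟨by omega, by omega⟩

/-- The transposed function. -/
def transpose (W : ℤ × ℤ → ℤ) : ℤ × ℤ → ℤ := fun d => W d.swap

theorem InitiallyZero.transpose {W : ℤ × ℤ → ℤ} (h : InitiallyZero W) :
    InitiallyZero (transpose W) := by
  obtain ⟨a, ha⟩ := h
  exact ⟨a, fun d hd => ha _ (by simpa [deg, add_comm] using hd)⟩

theorem IsRiemannFunction.transpose {f : ℤ × ℤ → ℤ} (h : IsRiemannFunction f) :
    IsRiemannFunction (transpose f) := by
  obtain ⟨h0, C, b, hb⟩ := h
  refine ⟨h0.transpose, C, b, fun d hd => ?_⟩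
  have := hb d.swap (by simpa [deg, add_comm] using hd)
  simpa [RiemannDuality.transpose, deg, add_comm] using this

theorem IsWeightOf.transpose {f W : ℤ × ℤ → ℤ} (h : IsWeightOf W f) :
    IsWeightOf (transpose W) (transpose f) := by
  refine ⟨h.1.transpose, fun d => ?_⟩
  rw [RiemannDuality.transpose, h.2]
  refine finsum_mem_eq_of_bijOn Prod.swap ⟨fun a h => ⟨h.2, h.1⟩, Prod.swap_injective.injOn,
    fun a h => ⟨a.swap, ⟨h.2, h.1⟩, a.swap_swap⟩⟩ fun a _ => by simp [RiemannDuality.transpose]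

/-- The quadrant below `(i, j)` is the quadrant below `(i - 1, j)` together with a half-line of row
`i`. -/
theorem IsWeightOf.sub_eq_finsum_row {f W : ℤ × ℤ → ℤ} (h : IsWeightOf W f) (i j : ℤ) :
    f (i, j) - f (i - 1, j) = ∑ᶠ j' ∈ Set.Iic j, W (i, j') := by
  have hu : Set.Iic (i, j) = Set.Iic (i - 1, j) ∪ (fun j' => (i, j')) '' Set.Iic j := by
    ext ⟨x, y⟩
    simp only [Set.mem_Iic, Prod.mk_le_mk, Set.mem_union, Set.mem_image, Prod.mk.injEq]
    constructor
    · rintro ⟨h1, h2⟩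
      by_cases hx : x = i
      · exact Or.inr ⟨y, h2, hx.symm, rfl⟩
      · exact Or.inl ⟨by omega, h2⟩
    · rintro (⟨h1, h2⟩ | ⟨y, h2, rfl, rfl⟩)
      · exact ⟨by omega, h2⟩
      · exact ⟨le_rfl, h2⟩
  have hfin := finite_Iic_inter_support h.1 (i, j)
  rw [hu, Set.union_inter_distrib_right] at hfin
  rw [h.2, h.2, hu, finsum_mem_union' _ (hfin.subset Set.subset_union_left)
    (hfin.subset Set.subset_union_right), finsum_mem_image fun x _ y _ e => (Prod.mk.inj e).2]
  · ring
  · rw [Set.disjoint_left]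
    rintro _ ⟨h1, _⟩ ⟨y, _, rfl⟩
    simp only at h1
    omega

theorem finsum_row_Iic_eq_one {f W : ℤ × ℤ → ℤ} (hf : IsRiemannFunction f) (hW : IsWeightOf W f) :
    ∃ b : ℤ, ∀ i j, b ≤ i + j → ∑ᶠ j' ∈ Set.Iic j, W (i, j') = 1 := by
  obtain ⟨_, C, b, hb⟩ := hf
  -- The extra `1` keeps `(i - 1, j)` in the range where `f` is linear as well.
  refine ⟨b + 1, fun i j hij => ?_⟩
  rw [← hW.sub_eq_finsum_row, hb _ (by simp only [deg]; omega), hb _ (by simp only [deg]; omega)]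
  simp only [deg]
  ring

/-- In large degree, two consecutive partial row sums are both `1`, so the entry between them
vanishes. -/
theorem IsWeightOf.eventuallyZero {f W : ℤ × ℤ → ℤ} (hf : IsRiemannFunction f)
    (hW : IsWeightOf W f) : EventuallyZero W := by
  obtain ⟨b, hb⟩ := finsum_row_Iic_eq_one hf hW
  refine ⟨b + 1, fun ⟨i, j⟩ hd => ?_⟩
  simp only [deg] at hd
  have hs : Set.Iic j = insert j (Set.Iic (j - 1)) := by
    ext x
    simp only [Set.mem_Iic, Set.mem_insert_iff]
    omega
  have h1 := hb i j (by omega)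
  rw [hs, finsum_mem_insert' _ (by simp), hb i (j - 1) (by omega)] at h1
  · omega
  · refine ((finite_Iic_inter_support hW.1 (i, j)).image Prod.snd).subset ?_
    rintro y ⟨h1, h2⟩
    exact ⟨(i, y), ⟨⟨le_rfl, (show y ≤ j - 1 from h1).trans (by simp)⟩, h2⟩, rfl⟩

/-- A partial row sum taken far enough out equals `1` and already contains all nonzero entries of
the row. -/
theorem IsWeightOf.finsum_row {f W : ℤ × ℤ → ℤ} (hf : IsRiemannFunction f)
    (hW : IsWeightOf W f) (i : ℤ) : ∑ᶠ j, W (i, j) = 1 := by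
  obtain ⟨b, hb⟩ := finsum_row_Iic_eq_one hf hW
  obtain ⟨b', hb'⟩ := hW.eventuallyZero hf
  rw [← hb i (max (b - i) (b' - i)) (by have := le_max_left (b - i) (b' - i); omega),
    ← finsum_mem_univ]
  refine finsum_mem_inter_support_eq' _ _ _ fun j hj => ⟨fun _ => ?_, fun _ => trivial⟩
  have h : ¬ b' ≤ deg (i, j) := fun h => hj (hb' _ h)
  have := le_max_right (b - i) (b' - i)
  simp only [deg] at h
  simp only [Set.mem_Iic]
  omega

theorem IsWeightOf.finsum_col {f W : ℤ × ℤ → ℤ} (hf : IsRiemannFunction f)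
    (hW : IsWeightOf W f) (j : ℤ) : ∑ᶠ i, W (i, j) = 1 :=
  hW.transpose.finsum_row hf.transpose j

/-- A nonnegative banded matrix all of whose row and column sums are `m` is the sum of `m` perfect
matchings. -/
theorem exists_perfectMatchings {A : ℤ × ℤ → ℤ} (h0 : InitiallyZero A) (h1 : EventuallyZero A)
    (hA : ∀ a, 0 ≤ A a) {m : ℕ} (hrow : ∀ i, ∑ᶠ j, A (i, j) = m)
    (hcol : ∀ j, ∑ᶠ i, A (i, j) = m) :
    ∃ M : Fin m → (ℤ × ℤ → ℤ), (∀ n, IsPerfectMatching (M n)) ∧ ∀ a, A a = ∑ n, M n a := by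
  obtain ⟨a, ha⟩ := h0
  obtain ⟨b, hb⟩ := h1
  have hr : ∀ i, (Function.support fun j => A (i, j)).Finite := fun i =>
    (Finset.finite_toSet _).subset (support_row_subset ha hb i)
  have hc : ∀ j, (Function.support fun i => A (i, j)).Finite := fun j =>
    (Finset.finite_toSet _).subset (support_row_subset (W := transpose A)
      (fun d hd => ha _ (by simpa [deg, add_comm] using hd))
      (fun d hd => hb _ (by simpa [deg, add_comm] using hd)) j)
  have hcast : ∀ i j, (((A (i, j)).toNat : ℕ) : ℤ) = A (i, j) := fun i j => Int.toNat_of_nonneg (hA _)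
  have hsup : ∀ i j, A (i, j) = 0 → (A (i, j)).toNat = 0 := fun i j h => by simp [h]
  have hr' : ∀ i, (Function.support fun j => (A (i, j)).toNat).Finite := fun i =>
    (hr i).subset fun j hj h => hj (hsup i j h)
  have hc' : ∀ j, (Function.support fun i => (A (i, j)).toNat).Finite := fun j =>
    (hc j).subset fun i hi h => hi (hsup i j h)
  obtain ⟨π, hπ⟩ := exists_equivs_of_regular (A := fun i j => (A (i, j)).toNat) (m := m) hr' hc'
    (fun i => by
      have h := hrow i
      rw [← Int.natCast_inj, ← h]
      exact (AddMonoidHom.map_finsum (Nat.castAddMonoidHom ℤ) (hr' i)).trans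
        (finsum_congr fun j => hcast i j))
    (fun j => by
      have h := hcol j
      rw [← Int.natCast_inj, ← h]
      exact (AddMonoidHom.map_finsum (Nat.castAddMonoidHom ℤ) (hc' j)).trans
        (finsum_congr fun i => hcast i j))
  have hsum : ∀ d : ℤ × ℤ, A d = ∑ n, if d.2 = π n d.1 then 1 else 0 := by
    rintro ⟨i, j⟩
    rw [← hcast, hπ]
    push_cast
    rfl
  -- Nonnegative summands vanish wherever their sum does, so each permutation matrix stays inside
  -- the band of `A`; this makes it initially and eventually zero.
  have hz : ∀ d, A d = 0 → ∀ n, (if d.2 = π n d.1 then (1 : ℤ) else 0) = 0 := by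
    intro d hd n
    rw [hsum, Finset.sum_eq_zero_iff_of_nonneg (fun n _ => by split_ifs <;> simp)] at hd
    exact hd n (Finset.mem_univ _)
  exact ⟨fun n d => if d.2 = π n d.1 then 1 else 0, fun n =>
    ⟨⟨a, fun d hd => hz d (ha d hd) n⟩, ⟨b, fun d hd => hz d (hb d hd) n⟩, π n, fun i j => rfl⟩,
    hsum⟩

/-- The function on `ℤ²` which is `c` in degrees in `(a, b)` and `0` in all other degrees. -/
def band (a b c : ℤ) : ℤ × ℤ → ℤ := fun d => if a < deg d ∧ deg d < b then c else 0

/-- Each row meets the band in as many points as there are integers strictly between `a` and `b`;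
`toNat` covers the empty band. -/
theorem finsum_band_row (a b c i : ℤ) : ∑ᶠ j, band a b c (i, j) = (b - a - 1).toNat * c := by
  rw [finsum_eq_sum_of_support_subset _ (support_row_subset (W := band a b c) (a := a)
    (b := b) (fun d hd => if_neg fun h => absurd h.1 (not_lt.2 hd))
    (fun d hd => if_neg fun h => absurd h.2 (not_lt.2 hd)) i),
    Finset.sum_congr rfl (g := fun _ => c), Finset.sum_const, Int.card_Ioo, nsmul_eq_mul]
  · congr 3
    ring
  · intro j hj
    rw [Finset.mem_Ioo] at hj
    refine if_pos ?_
    simp only [deg]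
    omega

theorem finsum_band_col (a b c j : ℤ) : ∑ᶠ i, band a b c (i, j) = (b - a - 1).toNat * c := by
  rw [← finsum_band_row a b c j]
  exact finsum_congr fun i => if_congr (by simp only [deg, add_comm]) rfl rfl

/-- Write `W = (W + band a b C) - band a b C`. The bound on `|W|` makes the first term nonnegative,
and both terms have constant line sums. -/
theorem nonempty_matchingDecomposition_of_regular {W : ℤ × ℤ → ℤ} (h0 : InitiallyZero W)
    (h1 : EventuallyZero W) {C : ℤ} (hC : ∀ a, |W a| ≤ C) (hrow : ∀ i, ∑ᶠ j, W (i, j) = 1)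
    (hcol : ∀ j, ∑ᶠ i, W (i, j) = 1) : Nonempty (MatchingDecomposition W) := by
  obtain ⟨a, ha⟩ := h0
  obtain ⟨b, hb⟩ := h1
  have hC0 : 0 ≤ C := (abs_nonneg _).trans (hC 0)
  have hba : ∀ d, deg d ≤ a → band a b C d = 0 := fun d hd =>
    if_neg fun h => absurd h.1 (not_lt.2 hd)
  have hbb : ∀ d, b ≤ deg d → band a b C d = 0 := fun d hd =>
    if_neg fun h => absurd h.2 (not_lt.2 hd)
  have hb0 : ∀ d, 0 ≤ band a b C d := fun d => by unfold band; split_ifs <;> simp [hC0]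
  have hcast : (((b - a - 1).toNat * C.toNat : ℕ) : ℤ) = (b - a - 1).toNat * C := by
    rw [Nat.cast_mul, Int.toNat_of_nonneg hC0]
  have hswap : ∀ V : ℤ × ℤ → ℤ, (∀ d, deg d ≤ a → V d = 0) → (∀ d, b ≤ deg d → V d = 0) → ∀ j,
      (Function.support fun i => V (i, j)).Finite := fun V h h' j =>
    (Finset.finite_toSet _).subset (support_row_subset (W := transpose V)
      (fun d hd => h _ (by simpa [deg, add_comm] using hd))
      (fun d hd => h' _ (by simpa [deg, add_comm] using hd)) j)
  obtain ⟨N, hN, hN'⟩ := exists_perfectMatchings (A := band a b C)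
    (m := (b - a - 1).toNat * C.toNat) ⟨a, hba⟩ ⟨b, hbb⟩ hb0
    (fun i => (finsum_band_row a b C i).trans hcast.symm)
    (fun j => (finsum_band_col a b C j).trans hcast.symm)
  -- The line sums of `W` are `1`, which gives exactly one more positive matching than negative
  -- ones.
  obtain ⟨P, hP, hP'⟩ := exists_perfectMatchings (A := fun d => W d + band a b C d)
    (m := (b - a - 1).toNat * C.toNat + 1)
    ⟨a, fun d hd => by simp only [ha d hd, hba d hd, add_zero]⟩
    ⟨b, fun d hd => by simp only [hb d hd, hbb d hd, add_zero]⟩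
    (fun d => by
      by_cases hd : a < deg d ∧ deg d < b
      · have := neg_le_of_abs_le (hC d)
        simp only [band, if_pos hd]
        omega
      · have hW : W d = 0 := by
          by_cases h : deg d ≤ a
          · exact ha d h
          · exact hb d (by omega)
        rw [hW, zero_add]
        exact hb0 d)
    (fun i => by
      rw [finsum_add_distrib ((Finset.finite_toSet _).subset (support_row_subset ha hb i))
        ((Finset.finite_toSet _).subset (support_row_subset hba hbb i)), hrow, finsum_band_row,
        Nat.cast_add, hcast, Nat.cast_one, add_comm])
    (fun j => by
      rw [finsum_add_distrib (hswap W ha hb j) (hswap _ hba hbb j), hcol, finsum_band_col,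
        Nat.cast_add, hcast, Nat.cast_one, add_comm])
  exact ⟨⟨_, P, N, hP, hN, fun d => by rw [← hP', ← hN', add_sub_cancel_right]⟩⟩

/-! ### Reflection of matchings and decompositions -/

theorem IsPerfectMatching.dualWeight {W : ℤ × ℤ → ℤ} (hW : IsPerfectMatching W) (L : ℤ × ℤ) :
    IsPerfectMatching (dualWeight L W) := by
  obtain ⟨⟨a, ha⟩, ⟨b, hb⟩, π, hπ⟩ := hW
  -- Reflection reverses degrees, so the two vanishing bounds trade places; the new permutation is
  -- `i ↦ L.2 - π (L.1 - i)`.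
  refine ⟨⟨deg L - b, fun d hd => hb _ ?_⟩, ⟨deg L - a, fun d hd => ha _ ?_⟩,
    ((Equiv.subLeft L.1).trans π).trans (Equiv.subLeft L.2), fun i j => ?_⟩
  · simp only [deg, Prod.fst_sub, Prod.snd_sub] at *
    omega
  · simp only [deg, Prod.fst_sub, Prod.snd_sub] at *
    omega
  · refine (hπ _ _).trans (if_congr ?_ rfl rfl)
    simp only [Equiv.trans_apply, Equiv.subLeft_apply]
    omega

/-- The termwise dual decomposition of the dual weight. -/
def MatchingDecomposition.dual {W : ℤ × ℤ → ℤ} (D : MatchingDecomposition W) (L : ℤ × ℤ) :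
    MatchingDecomposition (dualWeight L W) where
  s := D.s
  pos i := dualWeight L (D.pos i)
  neg j := dualWeight L (D.neg j)
  pos_perfect i := (D.pos_perfect i).dualWeight L
  neg_perfect j := (D.neg_perfect j).dualWeight L
  eq_sub d := D.eq_sub (L - d)

/-! ### The Betti numbers of `M_{W,d}` for a perfect matching `W` -/

section Betti

variable {k : Type u} [Field k] {W : ℤ × ℤ → ℤ}

theorem mapDomain_val_eq_zero {m n : ℤ} (b : {n : ℤ // n ≤ m} →₀ k) (hn : ¬ n ≤ m) :
    Finsupp.mapDomain (fun n : {n : ℤ // n ≤ m} => n.1) b n = 0 :=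
  Finsupp.mapDomain_of_notMem_range _ _ (by rintro ⟨x, rfl⟩; exact hn x.2)

/-- Together with `mapDomain_val_eq_zero`, this identifies the images of `ρ₁₁` and `ρ₂₂` with the
vectors supported on a half-line. -/
theorem exists_mapDomain_val_eq {m : ℤ} (y : ℤ →₀ k) (hy : ∀ n, ¬ n ≤ m → y n = 0) :
    ∃ b : {n : ℤ // n ≤ m} →₀ k, Finsupp.mapDomain (fun n : {n : ℤ // n ≤ m} => n.1) b = y := by
  refine ⟨_, Finsupp.mapDomain_comapDomain _ Subtype.val_injective y fun n hn => ?_⟩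
  by_contra h
  exact (Finsupp.mem_support_iff.1 hn) (hy n fun h' => h ⟨⟨n, h'⟩, rfl⟩)

/-- The kernel embeds in `B₃`, since `ρ₁₁` and `ρ₂₂` are injective. Its image is the space of
vectors supported on points `≤ d`: injective coordinate projections cause no cancellation, so both
projected vectors lie in the half-lines exactly under this condition. -/
theorem finrank_H_zero_diagramM (d : ℤ × ℤ) (h₁ : Function.Injective fun p : Multi W => p.1.1.1)
    (h₂ : Function.Injective fun p : Multi W => p.1.1.2) :
    Module.finrank k ((diagramM k W d).H 0) = Nat.card {p : Multi W // p.1.1 ≤ d} := by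
  change Module.finrank k (LinearMap.ker (diagramM k W d).differential) = _
  let φ : LinearMap.ker (diagramM k W d).differential →ₗ[k] (Multi W →₀ k) :=
    { toFun := fun b => b.1.2.2
      map_add' := fun _ _ => rfl
      map_smul' := fun _ _ => rfl }
  have hφ : Function.Injective φ := by
    refine (injective_iff_map_eq_zero φ).2 ?_
    rintro ⟨⟨(b₁ : {n : ℤ // n ≤ d.1} →₀ k), (b₂ : {n : ℤ // n ≤ d.2} →₀ k),
      (b₃ : Multi W →₀ k)⟩, hb⟩ (rfl : b₃ = 0)
    have e₁ : Finsupp.mapDomain (fun n : {n : ℤ // n ≤ d.1} => n.1) b₁ =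
        Finsupp.mapDomain (fun p : Multi W => p.1.1.1) 0 := sub_eq_zero.1 (congrArg Prod.fst hb :)
    have e₂ : Finsupp.mapDomain (fun n : {n : ℤ // n ≤ d.2} => n.1) b₂ =
        Finsupp.mapDomain (fun p : Multi W => p.1.1.2) 0 := sub_eq_zero.1 (congrArg Prod.snd hb :)
    rw [Finsupp.mapDomain_zero, ← Finsupp.mapDomain_zero] at e₁ e₂
    have h4 := Finsupp.mapDomain_injective Subtype.val_injective e₁
    have h5 := Finsupp.mapDomain_injective Subtype.val_injective e₂
    subst h4 h5
    rfl
  have hr : LinearMap.range φ = Finsupp.supported k k {p : Multi W | p.1.1 ≤ d} := by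
    ext b₃
    rw [Finsupp.mem_supported']
    constructor
    · rintro ⟨⟨⟨(b₁ : {n : ℤ // n ≤ d.1} →₀ k), (b₂ : {n : ℤ // n ≤ d.2} →₀ k),
        (b : Multi W →₀ k)⟩, hb⟩, (rfl : b = b₃)⟩ p hp
      have e₁ : Finsupp.mapDomain (fun n : {n : ℤ // n ≤ d.1} => n.1) b₁ =
          Finsupp.mapDomain (fun p : Multi W => p.1.1.1) b :=
        sub_eq_zero.1 (congrArg Prod.fst hb :)
      have e₂ : Finsupp.mapDomain (fun n : {n : ℤ // n ≤ d.2} => n.1) b₂ =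
          Finsupp.mapDomain (fun p : Multi W => p.1.1.2) b :=
        sub_eq_zero.1 (congrArg Prod.snd hb :)
      by_cases hp1 : p.1.1.1 ≤ d.1
      · rw [← Finsupp.mapDomain_apply h₂ b p, ← e₂]
        exact mapDomain_val_eq_zero _ fun h => hp ⟨hp1, h⟩
      · rw [← Finsupp.mapDomain_apply h₁ b p, ← e₁]
        exact mapDomain_val_eq_zero _ hp1
    · intro hb
      have key : ∀ (g : Multi W → ℤ) (m : ℤ), Function.Injective g →
          (∀ p : Multi W, p.1.1 ≤ d → g p ≤ m) → ∃ b : {n : ℤ // n ≤ m} →₀ k,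
            Finsupp.mapDomain (fun n : {n : ℤ // n ≤ m} => n.1) b = Finsupp.mapDomain g b₃ := by
        intro g m hg hm
        refine exists_mapDomain_val_eq _ fun n hn => ?_
        by_cases h : n ∈ Set.range g
        · obtain ⟨p, rfl⟩ := h
          rw [Finsupp.mapDomain_apply hg]
          exact hb p fun h => hn (hm p h)
        · exact Finsupp.mapDomain_of_notMem_range _ _ h
      obtain ⟨b₁, e₁⟩ := key (fun p => p.1.1.1) d.1 h₁ fun p h => h.1
      obtain ⟨b₂, e₂⟩ := key (fun p => p.1.1.2) d.2 h₂ fun p h => h.2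
      exact ⟨⟨(b₁, b₂, b₃), Prod.ext (sub_eq_zero.2 e₁) (sub_eq_zero.2 e₂)⟩, rfl⟩
  rw [(LinearEquiv.ofInjective φ hφ).finrank_eq, hr,
    (Finsupp.supportedEquivFinsupp {p : Multi W | p.1.1 ≤ d}).finrank_eq,
    Module.finrank_eq_nat_card_basis Finsupp.basisSingleOne]
  rfl

/-- Modulo `B₁` and `B₂` only coordinates above `d` survive, and `B₃` identifies the two coordinates
of a point up to sign. The invariant left at each point `≥ d + 1` is `x₁ - x₂`, recorded by `χ`; the
cokernel is therefore the target of `χ`. -/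
theorem finrank_H_one_diagramM (d : ℤ × ℤ) (h₁ : Function.Bijective fun p : Multi W => p.1.1.1)
    (h₂ : Function.Bijective fun p : Multi W => p.1.1.2) :
    Module.finrank k ((diagramM k W d).H 1) = Nat.card {p : Multi W // d + 1 ≤ p.1.1} := by
  let R : Submodule k ((ℤ →₀ k) × (ℤ →₀ k)) := LinearMap.range (diagramM k W d).differential
  change Module.finrank k (((ℤ →₀ k) × (ℤ →₀ k)) ⧸ R) = _
  let χ : ((ℤ →₀ k) × (ℤ →₀ k)) →ₗ[k] ({p : Multi W // d + 1 ≤ p.1.1} →₀ k) :=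
    Finsupp.lsubtypeDomain {p : Multi W | d + 1 ≤ p.1.1} ∘ₗ
      (Finsupp.lcomapDomain _ h₁.1 ∘ₗ LinearMap.fst k _ _ -
        Finsupp.lcomapDomain _ h₂.1 ∘ₗ LinearMap.snd k _ _)
  have hχ : ∀ x p, χ x p = x.1 p.1.1.1.1 - x.2 p.1.1.1.2 := fun _ _ => rfl
  have hmem : ∀ n : ℤ × ℤ, d + 1 ≤ n ↔ ¬ n.1 ≤ d.1 ∧ ¬ n.2 ≤ d.2 := fun n => by
    rw [not_le, not_le]
    exact and_congr Int.add_one_le_iff Int.add_one_le_iff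
  have hR : R = LinearMap.ker χ := by
    ext ⟨x₁, x₂⟩
    rw [LinearMap.mem_ker]
    constructor
    · rintro ⟨⟨(b₁ : {n : ℤ // n ≤ d.1} →₀ k), (b₂ : {n : ℤ // n ≤ d.2} →₀ k),
        (b₃ : Multi W →₀ k)⟩, hb⟩
      have e₁ : Finsupp.mapDomain (fun n : {n : ℤ // n ≤ d.1} => n.1) b₁ -
          Finsupp.mapDomain (fun p : Multi W => p.1.1.1) b₃ = x₁ := congrArg Prod.fst hb
      have e₂ : Finsupp.mapDomain (fun n : {n : ℤ // n ≤ d.2} => n.1) b₂ -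
          Finsupp.mapDomain (fun p : Multi W => p.1.1.2) b₃ = x₂ := congrArg Prod.snd hb
      ext ⟨p, hp⟩
      obtain ⟨hp1, hp2⟩ := (hmem _).1 hp
      have e₃ := Finsupp.mapDomain_apply h₁.1 b₃ p
      have e₄ := Finsupp.mapDomain_apply h₂.1 b₃ p
      rw [hχ, ← e₁, ← e₂, Finsupp.sub_apply, Finsupp.sub_apply, mapDomain_val_eq_zero _ hp1,
        mapDomain_val_eq_zero _ hp2, e₃, e₄, sub_self, Finsupp.zero_apply]
    · intro hx
      classical
      -- `B₁` cannot correct `x₁` above `d.1`, so there `b₃` must be `-x₁`; where only the second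
      -- coordinate exceeds its bound, `b₃` must be `-x₂`; elsewhere `0` will do. Where both exceed,
      -- the two requirements agree because `χ` vanishes.
      let b₃ : Multi W →₀ k :=
        -((Finsupp.lcomapDomain (R := k) _ h₁.1 x₁).filter (fun p => ¬ p.1.1.1 ≤ d.1) +
          (Finsupp.lcomapDomain (R := k) _ h₂.1 x₂).filter
            (fun p => p.1.1.1 ≤ d.1 ∧ ¬ p.1.1.2 ≤ d.2))
      have hb₃ : ∀ p, b₃ p = -((if ¬ p.1.1.1 ≤ d.1 then x₁ p.1.1.1 else 0) +
          (if p.1.1.1 ≤ d.1 ∧ ¬ p.1.1.2 ≤ d.2 then x₂ p.1.1.2 else 0)) := fun p => by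
        simp only [b₃, Finsupp.neg_apply, Finsupp.add_apply, Finsupp.filter_apply]
        rfl
      obtain ⟨b₁, e₁⟩ := exists_mapDomain_val_eq (m := d.1)
        (x₁ + Finsupp.mapDomain (fun p : Multi W => p.1.1.1) b₃) fun n hn => by
          obtain ⟨p, rfl⟩ := h₁.2 n
          rw [Finsupp.add_apply, Finsupp.mapDomain_apply h₁.1 b₃ p, hb₃, if_pos hn,
            if_neg fun h => hn h.1, add_zero, add_neg_cancel]
      obtain ⟨b₂, e₂⟩ := exists_mapDomain_val_eq (m := d.2)
        (x₂ + Finsupp.mapDomain (fun p : Multi W => p.1.1.2) b₃) fun n hn => by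
          obtain ⟨p, rfl⟩ := h₂.2 n
          rw [Finsupp.add_apply, Finsupp.mapDomain_apply h₂.1 b₃ p, hb₃]
          by_cases hp : p.1.1.1 ≤ d.1
          · rw [if_neg (not_not.2 hp), if_pos ⟨hp, hn⟩, zero_add, add_neg_cancel]
          · have h := DFunLike.congr_fun hx ⟨p, (hmem _).2 ⟨hp, hn⟩⟩
            rw [hχ, Finsupp.zero_apply, sub_eq_zero] at h
            simp only at h
            rw [if_pos hp, if_neg fun h => hp h.1, add_zero, h, add_neg_cancel]
      exact ⟨(b₁, b₂, b₃), Prod.ext (sub_eq_iff_eq_add.2 e₁) (sub_eq_iff_eq_add.2 e₂)⟩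
  have hs : Function.Surjective χ := fun c => by
    -- The first component alone suffices to reach every value of `χ`.
    refine ⟨(Finsupp.mapDomain (fun p : {p : Multi W // d + 1 ≤ p.1.1} => p.1.1.1.1) c, 0), ?_⟩
    ext p
    rw [hχ, Finsupp.zero_apply, sub_zero]
    exact Finsupp.mapDomain_apply (h₁.1.comp Subtype.val_injective) c p
  rw [((Submodule.quotEquivOfEq R _ hR).trans (χ.quotKerEquivOfSurjective hs)).finrank_eq,
    Module.finrank_eq_nat_card_basis Finsupp.basisSingleOne]

/-- The values of `W` are `0` and `1`, so the multiplicity label is forced to be `1` and `Multi W`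
is the graph of a permutation. -/
theorem IsPerfectMatching.multi_spec (hW : IsPerfectMatching W) :
    (∀ p : Multi W, W p.1.1 = 1 ∧ p.1.2 = 1) ∧
      (Function.Bijective fun p : Multi W => p.1.1.1) ∧
      Function.Bijective fun p : Multi W => p.1.1.2 := by
  obtain ⟨_, _, π, hπ⟩ := hW
  have hp : ∀ p : Multi W, p.1.1.2 = π p.1.1.1 ∧ p.1.2 = 1 := by
    rintro ⟨⟨⟨i, j⟩, m⟩, h1, h2⟩
    have h3 := hπ i j
    simp only at h1 h2 ⊢
    rw [h3] at h2
    split_ifs at h2 with h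
    · exact ⟨h, by omega⟩
    · omega
  have inj₁ : Function.Injective fun p : Multi W => p.1.1.1 := by
    intro p q h
    have h' : p.1.1.1 = q.1.1.1 := h
    exact Subtype.ext (Prod.ext (Prod.ext h' (by rw [(hp p).1, (hp q).1, h']))
      (by rw [(hp p).2, (hp q).2]))
  have inj₂ : Function.Injective fun p : Multi W => p.1.1.2 := by
    intro p q h
    have h' : p.1.1.2 = q.1.1.2 := h
    rw [(hp p).1, (hp q).1] at h'
    exact inj₁ (π.injective h')
  exact ⟨fun p => ⟨(hπ _ _).trans (if_pos (hp p).1), (hp p).2⟩,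
    ⟨inj₁, fun n => ⟨⟨((n, π n), 1), le_refl _, by simp [hπ]⟩, rfl⟩⟩,
    ⟨inj₂, fun n => ⟨⟨((π.symm n, n), 1), le_refl _, by simp [hπ]⟩, rfl⟩⟩⟩

theorem IsPerfectMatching.card_multi (hW : IsPerfectMatching W) {S : Set (ℤ × ℤ)}
    (hS : (S ∩ Function.support W).Finite) :
    (Nat.card {p : Multi W // p.1.1 ∈ S} : ℤ) = ∑ᶠ a ∈ S, W a := by
  have hp := hW.multi_spec.1
  have h01 : ∀ a ∈ S ∩ Function.support W, W a = 1 := by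
    rintro ⟨i, j⟩ ⟨_, h⟩
    obtain ⟨_, _, π, hπ⟩ := hW
    rw [Function.mem_support, hπ] at h
    rw [hπ]
    split_ifs at h ⊢ with h'
    · rfl
    · exact absurd rfl h
  have e : Nat.card {p : Multi W // p.1.1 ∈ S} = Nat.card ↑(S ∩ Function.support W) := by
    refine Nat.card_congr (Equiv.ofBijective (fun p => ⟨p.1.1.1, p.2, ?_⟩) ⟨?_, ?_⟩)
    · rw [Function.mem_support, (hp p.1).1]
      exact one_ne_zero
    · intro p q h
      exact Subtype.ext (Subtype.ext (Prod.ext (congrArg Subtype.val h)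
        (by rw [(hp p.1).2, (hp q.1).2])))
    · rintro ⟨a, ha⟩
      exact ⟨⟨⟨(a, 1), le_rfl, (h01 a ha).ge⟩, ha.1⟩, rfl⟩
  rw [← finsum_mem_inter_support, finsum_mem_congr rfl h01, e, Nat.card_coe_set_eq,
    finsum_mem_eq_finite_toFinset_sum _ hS, Finset.sum_const, nsmul_one,
    Set.ncard_eq_toFinset_card _ hS]

/-- The region over which `W` is summed to give the `i`-th Betti number of `M_{W,d}`. -/
def bettiRegion (d : ℤ × ℤ) : Fin 2 → Set (ℤ × ℤ)
  | 0 => Set.Iic d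
  | 1 => Set.Ici (d + 1)

theorem IsPerfectMatching.finite_bettiRegion_inter_support (hW : IsPerfectMatching W) (d : ℤ × ℤ)
    (i : Fin 2) : (bettiRegion d i ∩ Function.support W).Finite := by
  match i with
  | 0 => exact finite_Iic_inter_support hW.1 d
  | 1 =>
    obtain ⟨b, hb⟩ := hW.2.1
    refine (Set.finite_Icc d ((b - d.2, b - d.1) : ℤ × ℤ)).subset ?_
    rintro ⟨i, j⟩ ⟨⟨h1, h2⟩, h3⟩
    have h4 : ¬ b ≤ deg (i, j) := fun h => h3 (hb _ h)
    simp only [deg, Prod.fst_add, Prod.snd_add, Prod.fst_one, Prod.snd_one] at h1 h2 h4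
    exact ⟨⟨by omega, by omega⟩, by simp only; omega, by simp only; omega⟩

theorem IsPerfectMatching.finrank_H (hW : IsPerfectMatching W) (d : ℤ × ℤ) (i : Fin 2) :
    (Module.finrank k ((diagramM k W d).H i) : ℤ) = ∑ᶠ a ∈ bettiRegion d i, W a := by
  obtain ⟨_, h₁, h₂⟩ := hW.multi_spec
  rw [← hW.card_multi (hW.finite_bettiRegion_inter_support d i)]
  match i with
  | 0 => exact congrArg _ (finrank_H_zero_diagramM d h₁.1 h₂.1)
  | 1 => exact congrArg _ (finrank_H_one_diagramM d h₁ h₂)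

end Betti

/-! ### Virtual vector spaces are determined by their dimension -/

section Dimension

variable {k : Type u} [Field k]

/-- The dimension of a finite-dimensional vector space, as a homomorphism. -/
noncomputable def VecClass.dim : VecClass k →+ ℤ where
  toFun := Quotient.lift (fun V => (Module.finrank k V : ℤ))
    (fun _ _ ⟨e⟩ => congrArg _ e.finrank_eq)
  map_zero' := congrArg Nat.cast (Module.finrank_zero_of_subsingleton (R := k) (M := PUnit.{u + 1}))
  map_add' := by
    rintro ⟨V⟩ ⟨W⟩
    exact (congrArg Nat.cast (Module.finrank_prod (R := k) (M := V) (M' := W))).trans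
      (Nat.cast_add _ _)

theorem VecClass.dim_injective : Function.Injective (VecClass.dim (k := k)) := by
  rintro ⟨V⟩ ⟨W⟩ h
  exact Quotient.sound ⟨LinearEquiv.ofFinrankEq V W (Nat.cast_injective (R := ℤ) h)⟩

theorem VecClass.dim_dual (x : VecClass k) : VecClass.dim (VecClass.dual x) = VecClass.dim x := by
  obtain ⟨V⟩ := x
  exact congrArg Nat.cast (Subspace.dual_finrank_eq (K := k) (V := V))

/-- The dimension of a virtual vector space: `dim (V₁ ⊖ V₂) = dim V₁ - dim V₂`. -/
noncomputable def VirtualSpace.dim : VirtualSpace k →+ ℤ :=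
  Algebra.GrothendieckAddGroup.lift VecClass.dim

theorem VirtualSpace.dim_of (x : VecClass k) :
    VirtualSpace.dim (Algebra.GrothendieckAddGroup.of x) = VecClass.dim x :=
  DFunLike.congr_fun (Algebra.GrothendieckAddGroup.lift.symm_apply_apply VecClass.dim) x

theorem grothendieck_exists_eq_sub {M : Type*} [AddCommMonoid M]
    (x : Algebra.GrothendieckAddGroup M) :
    ∃ a b : M, x = Algebra.GrothendieckAddGroup.of a - Algebra.GrothendieckAddGroup.of b := by
  obtain ⟨⟨a, b⟩, h⟩ := (AddLocalization.addMonoidOf (⊤ : AddSubmonoid M)).surj x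
  exact ⟨a, b, eq_sub_of_add_eq h⟩

/-- A difference of dimension zero has isomorphic terms, so it is zero. This turns the duality
isomorphism into an equality of integers. -/
theorem VirtualSpace.dim_injective : Function.Injective (VirtualSpace.dim (k := k)) := by
  refine (injective_iff_map_eq_zero _).2 fun x hx => ?_
  obtain ⟨a, b, rfl⟩ := grothendieck_exists_eq_sub x
  rw [map_sub, dim_of, dim_of, sub_eq_zero] at hx
  rw [VecClass.dim_injective hx, sub_self]

theorem VirtualSpace.dim_dual (x : VirtualSpace k) :
    VirtualSpace.dim (VirtualSpace.dual x) = VirtualSpace.dim x := by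
  obtain ⟨a, b, rfl⟩ := grothendieck_exists_eq_sub x
  have h : ∀ y : VecClass k, VirtualSpace.dual (Algebra.GrothendieckAddGroup.of y) =
      Algebra.GrothendieckAddGroup.of (VecClass.dual y) := fun y =>
    DFunLike.congr_fun (Algebra.GrothendieckAddGroup.lift.symm_apply_apply
      (Algebra.GrothendieckAddGroup.of.comp VecClass.dual)) y
  rw [map_sub, map_sub, map_sub, h, h, dim_of, dim_of, dim_of, dim_of, VecClass.dim_dual,
    VecClass.dim_dual]

theorem VirtualDiagram.H_of (i : Fin 2) (x : DiagramClass k) :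
    VirtualDiagram.H i (Algebra.GrothendieckAddGroup.of x) =
      Algebra.GrothendieckAddGroup.of (DiagramClass.H i x) :=
  DFunLike.congr_fun (Algebra.GrothendieckAddGroup.lift.symm_apply_apply
    (Algebra.GrothendieckAddGroup.of.comp (DiagramClass.H i))) x

theorem IsPerfectMatching.dim_H_matchingClass {W : ℤ × ℤ → ℤ} (hW : IsPerfectMatching W)
    (d : ℤ × ℤ) (i : Fin 2) :
    VecClass.dim (DiagramClass.H i (matchingClass k hW d)) = ∑ᶠ a ∈ bettiRegion d i, W a :=
  hW.finrank_H d i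

/-- Additivity over the matchings leaves a sum depending only on `W`, which is why arbitrary
decompositions of the two weights can be compared. -/
theorem MatchingDecomposition.dim_H_virtualDiagram {W : ℤ × ℤ → ℤ} (D : MatchingDecomposition W)
    (d : ℤ × ℤ) (i : Fin 2) :
    VirtualSpace.dim (VirtualDiagram.H i (D.virtualDiagram k d)) =
      ∑ᶠ a ∈ bettiRegion d i, W a := by
  -- Indicators turn sums over the region into sums over all of `ℤ²`; their finite supports license
  -- linearity of `finsum`.
  have hfin : ∀ {n : ℕ} (M : Fin n → (ℤ × ℤ → ℤ)), (∀ j, IsPerfectMatching (M j)) → ∀ j,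
      (Function.support ((bettiRegion d i).indicator (M j))).Finite := fun M hM j => by
    rw [Set.support_indicator]
    exact (hM j).finite_bettiRegion_inter_support d i
  have hsum : ∀ {n : ℕ} (M : Fin n → (ℤ × ℤ → ℤ)), (∀ j, IsPerfectMatching (M j)) →
      (Function.support fun a => ∑ j, (bettiRegion d i).indicator (M j) a).Finite := fun M hM =>
    (Set.finite_iUnion (hfin M hM)).subset fun a ha => by
      obtain ⟨j, _, hj⟩ := Finset.exists_ne_zero_of_sum_ne_zero ha
      exact Set.mem_iUnion.2 ⟨j, hj⟩
  have hind : ∀ a, (bettiRegion d i).indicator W a =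
      ∑ j, (bettiRegion d i).indicator (D.pos j) a -
        ∑ j, (bettiRegion d i).indicator (D.neg j) a := fun a => by
    by_cases ha : a ∈ bettiRegion d i
    · simp only [Set.indicator_of_mem ha, D.eq_sub]
    · simp only [Set.indicator_of_notMem ha, Finset.sum_const_zero, sub_self]
  rw [virtualDiagram, map_sub, map_sub, VirtualDiagram.H_of, VirtualDiagram.H_of,
    VirtualSpace.dim_of, VirtualSpace.dim_of, map_sum, map_sum, map_sum, map_sum,
    finsum_mem_def, finsum_congr hind, finsum_sub_distrib (hsum _ D.pos_perfect)
      (hsum _ D.neg_perfect), finsum_sum_comm _ _ fun j _ => hfin _ D.pos_perfect j,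
    finsum_sum_comm _ _ fun j _ => hfin _ D.neg_perfect j]
  simp only [IsPerfectMatching.dim_H_matchingClass, finsum_mem_def]

end Dimension

/-- The reflection `a ↦ K + 1 - a` exchanges lower and upper quadrants, and `1 - i` swaps the
indices `0` and `1`. The shift from `K` to `K + 1` compensates for the upper region starting at `d +
1` rather than at `d`. -/
theorem finsum_bettiRegion_dualWeight (W : ℤ × ℤ → ℤ) (d K : ℤ × ℤ) (i : Fin 2) :
    ∑ᶠ a ∈ bettiRegion (K - d) (1 - i), dualWeight (K + 1) W a = ∑ᶠ a ∈ bettiRegion d i, W a := by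
  have hmem : ∀ a, a ∈ bettiRegion (K - d) (1 - i) ↔ K + 1 - a ∈ bettiRegion d i := fun a => by
    match i with
    | 0 =>
      change K - d + 1 ≤ a ↔ K + 1 - a ≤ d
      rw [sub_le_comm, sub_add_eq_add_sub]
    | 1 =>
      change a ≤ K - d ↔ d + 1 ≤ K + 1 - a
      rw [le_sub_comm, le_sub_iff_add_le, le_sub_iff_add_le, add_right_comm, add_le_add_iff_right]
  refine finsum_mem_eq_of_bijOn (fun a => K + 1 - a) ⟨fun a ha => (hmem a).1 ha,
    sub_right_injective.injOn, fun a ha => ⟨K + 1 - a, (hmem _).2 ?_, sub_sub_cancel _ _⟩⟩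
    fun a _ => rfl
  rwa [sub_sub_cancel]

end RiemannDuality

theorem mainTheorem10 (k : Type u) [Field k] (f W : ℤ × ℤ → ℤ)
    (hf : RiemannDuality.IsRiemannFunction f) (hW : RiemannDuality.IsWeightOf W f)
    (d K L : ℤ × ℤ) (hL : L = K + 1) :
    ((∃ C : ℤ, ∀ a, |W a| ≤ C) →
      Nonempty (RiemannDuality.MatchingDecomposition W) ∧
      Nonempty (RiemannDuality.MatchingDecomposition (RiemannDuality.dualWeight L W))) ∧
    ∀ (D : RiemannDuality.MatchingDecomposition W)
      (D' : RiemannDuality.MatchingDecomposition (RiemannDuality.dualWeight L W)) (i : Fin 2),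
      RiemannDuality.VirtualSpace.dual
          (RiemannDuality.VirtualDiagram.H i (D.virtualDiagram k d)) =
        RiemannDuality.VirtualDiagram.H (1 - i) (D'.virtualDiagram k (K - d)) := by
  subst hL
  refine ⟨fun ⟨C, hC⟩ => ?_, fun D D' i => ?_⟩
  · obtain ⟨D⟩ := RiemannDuality.nonempty_matchingDecomposition_of_regular hW.1
      (hW.eventuallyZero hf) hC (hW.finsum_row hf) (hW.finsum_col hf)
    exact ⟨⟨D⟩, ⟨D.dual (K + 1)⟩⟩
  · apply RiemannDuality.VirtualSpace.dim_injective
    rw [RiemannDuality.VirtualSpace.dim_dual, D.dim_H_virtualDiagram, D'.dim_H_virtualDiagram,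
      RiemannDuality.finsum_bettiRegion_dualWeight]
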